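/- **Theorem 3.1 (Convergence of the bounded degree SDP-SOCP hierarchy and duality).** Let $n=n_1+n_2$ with integers $n_1,n_2\ge 0$, let $f,g_1,\dots,g_m\in\mathbb R[x]=\mathbb R[x_1,\dots,x_n]$ have degree at most $d$, let $K=\{x\in\mathbb R^n : g_i(x)\ge 0,\ i=1,\dots,m\}$ and $\mathrm{val}(P)=\inf_{x\in K} f(x)$. Assume that $K$ is nonempty and compact and that $\{1,g_1,\dots,g_m\}$ generates $\mathbb R[x]$ as an $\mathbb R$-algebra. Let $M>0$ satisfy $M>\max_i\sup_{x\in K}g_i(x)$, put $\widehat g_i=g_i/M$ and $h_{p,q}=\prod_{i=1}^m\widehat g_i^{\,p_i}(1-\widehat g_i)^{q_i}$ for $p,q\in\mathbb N_0^m$, and fix a positive even integer $r$. Write $X_1=(x_1,\dots,x_{n_1})$, $X_2=(x_{n_1+1},\dots,x_n)$. Let $\Sigma^2_{n_1,r}$ be the set of sums of squares of real polynomials in $X_1$ that have degree at most $r$, and let $\mathbf{SDSOS}_{n_2,r}$ be the set of polynomials in $X_2$ of degree at most $r$ of the form $$\sum_i\alpha_i m_i^2+\sum_{i\ne j}(\beta^+_{ij}m_i+\gamma^+_{ij}m_j)^2+\sum_{i\ne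 j}(\beta^-_{ij}m_i-\gamma^-_{ij}m_j)^2$$ with finitely many distinct monomials $m_i$ and nonnegative coefficients $\alpha_i,\beta^\pm_{ij},\gamma^\pm_{ij}$; by convention $\Sigma^2_{0,r}=\mathbf{SDSOS}_{0,r}=\{0\}$. For an integer $k\ge 1$ let $\mathrm{val}(RP^r_k)\in[-\infty,+\infty]$ be the supremum of all $\mu\in\mathbb R$ for which there are $c_{p,q}\ge0$, $\sigma_1\in\Sigma^2_{n_1,r}$ and $\sigma_2\in\mathbf{SDSOS}_{n_2,r}$ with $$f-\sum_{|p|+|q|\le k}c_{p,q}\,h_{p,q}-\mu=\sigma_1+\sigma_2$$ (it is $-\infty$ if there is no such $\mu$). Let $D=\max\{kd,r\}$. For $y=(y_a)_{a\in\mathbb N_0^n,\ |a|\le D}$ put $L_y(\sum_a p_ax^a)=\sum_{|a|\le D} p_ay_a$, and for $j=1,2$ let $\mathbf M^{X_j}(y)$ be the matrix with entries $y_{a+b}$, whose rows $a$ and columns $b$ run over the multi-indices of degree at most $r/2$ supported in the variables $X_j$. Let $\mathrm{val}(DRP^r_k)\in[-\infty,+\infty]$ be the infimum of $L_y(f)$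 over all $y$ such that $L_y(h_{p,q})\ge 0$ whenever $|p|+|q|\le k$, $y_0=1$, $\mathbf M^{X_1}(y)\succeq 0$, and, with $Q=\mathbf M^{X_2}(y)$, $\|(2Q_{ab},\,Q_{aa}-Q_{bb})\|_2\le Q_{aa}+Q_{bb}$ for all $a,b$. Then: (i) For all $k\ge1$: $\mathrm{val}(RP^r_k)\le\mathrm{val}(RP^r_{k+1})$, $\mathrm{val}(DRP^r_k)\le\mathrm{val}(DRP^r_{k+1})$, and $\mathrm{val}(RP^r_k)\le\mathrm{val}(DRP^r_k)\le\mathrm{val}(P)$. Moreover $\lim_{k\to\infty}\mathrm{val}(RP^r_k)=\lim_{k\to\infty}\mathrm{val}(DRP^r_k)=\mathrm{val}(P)$. (ii) If $K$ has nonempty interior and there is $x_0\in K$ with $g_i(x_0)>0$ for all $i$, then for each $k\ge 1$ one has $\mathrm{val}(RP^r_k)=\mathrm{val}(DRP^r_k)$, and the supremum $\mathrm{val}(RP^r_k)$ is attained whenever it is not $-\infty$ (that is, whenever $(RP^r_k)$ is feasible). -/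

import Mathlib

open MvPolynomial Topology Filter

namespace SDPSOCP

/-- The feasible set `K = {x ∈ ℝⁿ | gᵢ(x) ≥ 0, i = 1, …, m}`. -/
def feasibleSet {n m : ℕ} (g : Fin m → MvPolynomial (Fin n) ℝ) : Set (Fin n → ℝ) :=
  {x | ∀ i, 0 ≤ eval x (g i)}

/-- The optimal value `inf {f(x) | x ∈ K}` of the polynomial optimization problem (P). -/
noncomputable def valP {n m : ℕ} (f : MvPolynomial (Fin n) ℝ)
    (g : Fin m → MvPolynomial (Fin n) ℝ) : EReal :=
  ⨅ x ∈ feasibleSet g, ((eval x f : ℝ) : EReal)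

/-! ### Sums of squares and scaled diagonally dominant sums of squares -/

/-- Sums of squares of real polynomials in `n` variables, of degree at most `d`.
By convention this is `{0}` when there are no variables. -/
def SOS (n d : ℕ) : Set (MvPolynomial (Fin n) ℝ) :=
  {s | IsSumSq s ∧ s.totalDegree ≤ d ∧ (n = 0 → s = 0)}

/-- Scaled diagonally dominant sums of squares: for some finite set `S` of (pairwise distinct)
monomials `xᵃ` and nonnegative coefficients,
`∑ αₐ (xᵃ)² + ∑_{a ≠ b} (β⁺ xᵃ + γ⁺ xᵇ)² + ∑_{a ≠ b} (β⁻ xᵃ - γ⁻ xᵇ)²`. -/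
def IsSDSOS {n : ℕ} (s : MvPolynomial (Fin n) ℝ) : Prop :=
  ∃ (S : Finset (Fin n →₀ ℕ)) (α : (Fin n →₀ ℕ) → ℝ)
    (βp γp βm γm : (Fin n →₀ ℕ) → (Fin n →₀ ℕ) → ℝ),
    (∀ a, 0 ≤ α a) ∧
    (∀ a b, 0 ≤ βp a b ∧ 0 ≤ γp a b ∧ 0 ≤ βm a b ∧ 0 ≤ γm a b) ∧
    s = ∑ a ∈ S, C (α a) * monomial a 1 ^ 2
      + ∑ e ∈ S.offDiag, (C (βp e.1 e.2) * monomial e.1 1 + C (γp e.1 e.2) * monomial e.2 1) ^ 2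
      + ∑ e ∈ S.offDiag, (C (βm e.1 e.2) * monomial e.1 1 - C (γm e.1 e.2) * monomial e.2 1) ^ 2

/-- Scaled diagonally dominant sums of squares in `n` variables, of degree at most `d`.
By convention this is `{0}` when there are no variables. -/
def SDSOS (n d : ℕ) : Set (MvPolynomial (Fin n) ℝ) :=
  {s | IsSDSOS s ∧ s.totalDegree ≤ d ∧ (n = 0 → s = 0)}

/-! ### The primal relaxation -/

/-- The normalized constraint `ĝ = g / M`. -/
noncomputable def hat {n : ℕ} (M : ℝ) (g : MvPolynomial (Fin n) ℝ) : MvPolynomial (Fin n) ℝ :=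
  C M⁻¹ * g

/-- `h_{p,q} = ∏ᵢ ĝᵢ^{pᵢ} (1 - ĝᵢ)^{qᵢ}`. -/
noncomputable def hPoly {n m : ℕ} (M : ℝ) (g : Fin m → MvPolynomial (Fin n) ℝ)
    (pq : (Fin m → ℕ) × (Fin m → ℕ)) : MvPolynomial (Fin n) ℝ :=
  ∏ i, hat M (g i) ^ pq.1 i * (1 - hat M (g i)) ^ pq.2 i

/-- The finite set of pairs `(p, q)` with `|p| + |q| ≤ k`. -/
def levelIdx (m k : ℕ) : Finset ((Fin m → ℕ) × (Fin m → ℕ)) :=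
  ((Fintype.piFinset fun _ => Finset.range (k + 1)) ×ˢ
    (Fintype.piFinset fun _ => Finset.range (k + 1))).filter
      fun pq => ∑ i, pq.1 i + ∑ i, pq.2 i ≤ k

theorem mem_levelIdx {m k : ℕ} (pq : (Fin m → ℕ) × (Fin m → ℕ)) :
    pq ∈ levelIdx m k ↔ ∑ i, pq.1 i + ∑ i, pq.2 i ≤ k := by
  simp only [levelIdx, Finset.mem_filter, Finset.mem_product, Fintype.mem_piFinset,
    Finset.mem_range, and_iff_right_iff_imp]
  intro h
  refine ⟨fun i => ?_, fun i => ?_⟩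
  · have := Finset.single_le_sum (f := pq.1) (fun j _ => Nat.zero_le _) (Finset.mem_univ i)
    omega
  · have := Finset.single_le_sum (f := pq.2) (fun j _ => Nat.zero_le _) (Finset.mem_univ i)
    omega

/-- The feasible objective values `μ` of the relaxation `(RP_k^r)`: there are `c_{p,q} ≥ 0`, a sum
of squares `σ₁` in the first `n₁` variables and a scaled diagonally dominant sum of squares `σ₂` in
the last `n₂` variables, both of degree at most `r`, with
`f - ∑_{|p|+|q| ≤ k} c_{p,q} h_{p,q} - μ = σ₁ + σ₂`. -/
def feasRP (n₁ n₂ : ℕ) {m : ℕ} (f : MvPolynomial (Fin (n₁ + n₂)) ℝ)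
    (g : Fin m → MvPolynomial (Fin (n₁ + n₂)) ℝ) (M : ℝ) (r k : ℕ) : Set ℝ :=
  {μ | ∃ c : (Fin m → ℕ) × (Fin m → ℕ) → ℝ, (∀ pq, 0 ≤ c pq) ∧
    ∃ σ₁ ∈ SOS n₁ r, ∃ σ₂ ∈ SDSOS n₂ r,
      f - ∑ pq ∈ levelIdx m k, C (c pq) * hPoly M g pq - C μ
        = rename (Fin.castAdd n₂) σ₁ + rename (Fin.natAdd n₁) σ₂}

/-- The optimal value of `(RP_k^r)`; it is `-∞` if the relaxation is infeasible. -/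
noncomputable def valRP (n₁ n₂ : ℕ) {m : ℕ} (f : MvPolynomial (Fin (n₁ + n₂)) ℝ)
    (g : Fin m → MvPolynomial (Fin (n₁ + n₂)) ℝ) (M : ℝ) (r k : ℕ) : EReal :=
  ⨆ μ ∈ feasRP n₁ n₂ f g M r k, (μ : EReal)

/-! ### The moment dual -/

/-- Multi-indices in `n` variables of degree at most `D`; there are `s(D, n)` of them. -/
abbrev MIdx (n D : ℕ) : Type := {a : Fin n →₀ ℕ // a.degree ≤ D}

noncomputable instance (n D : ℕ) : Fintype (MIdx n D) :=
  (Finsupp.finite_of_degree_le D).fintype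

/-- The Riesz functional `L_y(p) = ∑_{|a| ≤ D} pₐ yₐ`. -/
noncomputable def riesz {n D : ℕ} (y : MIdx n D → ℝ) (p : MvPolynomial (Fin n) ℝ) : ℝ :=
  ∑ a, coeff a.1 p * y a

/-- The moment matrix `M_u(y)`, that is, `L_y` applied entrywise to `x^{(u)} (x^{(u)})ᵀ`. Its
`(a, b)` entry is `y_{a+b}` as soon as `2 u ≤ D`. -/
noncomputable def momentMatrix {n D : ℕ} (u : ℕ) (y : MIdx n D → ℝ) :
    Matrix (MIdx n u) (MIdx n u) ℝ :=
  Matrix.of fun a b => riesz y (monomial a.1 1 * monomial b.1 1)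

/-- The submatrix of the moment matrix on the rows and columns whose multi-index is supported
in the set `V` of variables. -/
noncomputable def momentSubmatrix {n D : ℕ} (u : ℕ) (V : Set (Fin n)) (y : MIdx n D → ℝ) :
    Matrix {a : MIdx n u // (a.1.support : Set (Fin n)) ⊆ V}
      {a : MIdx n u // (a.1.support : Set (Fin n)) ⊆ V} ℝ :=
  (momentMatrix u y).submatrix Subtype.val Subtype.val

/-- The indices of the first `n₁` variables. -/
def firstVars (n₁ n₂ : ℕ) : Set (Fin (n₁ + n₂)) := Set.range (Fin.castAdd n₂)

/-- The indices of the last `n₂` variables. -/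
def lastVars (n₁ n₂ : ℕ) : Set (Fin (n₁ + n₂)) := Set.range (Fin.natAdd n₁)

/-- The second-order cone conditions
`‖(2 Qᵢⱼ, Qᵢᵢ - Qⱼⱼ)‖ ≤ Qᵢᵢ + Qⱼⱼ` (Euclidean norm) for all `i, j`. -/
def SOCondition {ι : Type} (Q : Matrix ι ι ℝ) : Prop :=
  ∀ i j, ‖!₂[2 * Q i j, Q i i - Q j j]‖ ≤ Q i i + Q j j

/-- The feasible set of the dual `(DRP_k^r)`, in the space `ℝ^{s(D,n)}` with `D = max {k d, r}`. -/
def feasDRP (n₁ n₂ : ℕ) {m : ℕ} (g : Fin m → MvPolynomial (Fin (n₁ + n₂)) ℝ) (M : ℝ)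
    (d r k : ℕ) : Set (MIdx (n₁ + n₂) (max (k * d) r) → ℝ) :=
  {y | (∀ pq ∈ levelIdx m k, 0 ≤ riesz y (hPoly M g pq)) ∧
    y ⟨0, by simp⟩ = 1 ∧
    (momentSubmatrix (r / 2) (firstVars n₁ n₂) y).PosSemidef ∧
    SOCondition (momentSubmatrix (r / 2) (lastVars n₁ n₂) y)}

/-- The optimal value of `(DRP_k^r)`. -/
noncomputable def valDRP (n₁ n₂ : ℕ) {m : ℕ} (f : MvPolynomial (Fin (n₁ + n₂)) ℝ)
    (g : Fin m → MvPolynomial (Fin (n₁ + n₂)) ℝ) (M : ℝ) (d r k : ℕ) : EReal :=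
  ⨅ y ∈ feasDRP n₁ n₂ g M d r k, (riesz y f : EReal)

end SDPSOCP

namespace SDPSOCP

/-! ### Archimedean semialgebras, states and characters -/

section Positivstellensatz

open scoped NNReal

variable {A : Type*} [CommRing A] [Algebra ℝ A]

/-! Convergence rests on a Krivine-Kadison-Dubois Positivstellensatz. Let `T` be the semialgebra
generated by the `ĝᵢ` and `1 - ĝᵢ`; its elements are the nonnegative combinations of the `h_{p,q}`.
Since the `gᵢ` generate the polynomial ring, `T` is archimedean. If some `f` were outside `T`, Riesz
extension would give a state `L ≥ 0` on `T` with `L f ≤ 0`. The states form a compact convex set, so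
`L` may be taken extreme; extreme states are multiplicative, hence point evaluations, and the point
lies in `K`. So every polynomial positive on `K` lies in `T` (`exists_level_of_pos`). For `μ <
val(P)` this applies to `f - μ`, with `σ₁ = σ₂ = 0`, and `val(RP)` eventually exceeds any number
below `val(P)`.

The upper bounds are weak duality. Dual feasibility says that `L_y` is nonnegative on the `h_{p,q}`,
on squares in `X₁` and on squares of binomials in `X₂` (`mem_feasDRP_iff`). Leading terms of real
squares cannot cancel, so a degree bound on `σ₁` or `σ₂` bounds every square in it, and applying
`L_y` to a certificate gives `μ ≤ L_y(f)`. Moments of Dirac measures at points of `K` are dual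
feasible.

Strong duality is Farkas' lemma for a closed cone. The primal cone is generated by a compact set of
coefficient vectors. Interior points of `K` and the Slater point keep `0` out of the convex hull of
that set, so the cone is closed. If `f - μ` is outside it, a separating functional, normalized or
mixed with a Dirac measure, is a dual point of value below `μ`. Hence the dual value, when finite,
is itself primal feasible, which gives equality and attainment together. -/

theorem real_smul_mem (T : Subalgebra ℝ≥0 A) {c : ℝ} (hc : 0 ≤ c) {t : A} (ht : t ∈ T) :
    c • t ∈ T :=
  T.smul_mem ht (⟨c, hc⟩ : ℝ≥0)

/-- A subsemialgebra containing `g` and `1 - g` for all `g` in a generating set is archimedean. -/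
theorem exists_bound_of_adjoin_eq_top (T : Subalgebra ℝ≥0 A) {G : Set A}
    (hG : ∀ g ∈ G, g ∈ T ∧ 1 - g ∈ T) (hadj : Algebra.adjoin ℝ G = ⊤) (p : A) :
    ∃ N : ℝ, 0 ≤ N ∧ N • (1 : A) - p ∈ T ∧ N • (1 : A) + p ∈ T := by
  have hp : p ∈ Algebra.adjoin ℝ G := hadj ▸ Algebra.mem_top
  induction hp using Algebra.adjoin_induction with
  | mem x hx =>
    refine ⟨1, zero_le_one, ?_, ?_⟩
    · simpa using (hG x hx).2
    · simpa using T.add_mem T.one_mem (hG x hx).1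
  | algebraMap c =>
    refine ⟨|c|, abs_nonneg c, ?_, ?_⟩
    · rw [Algebra.algebraMap_eq_smul_one, ← sub_smul]
      exact real_smul_mem T (sub_nonneg.2 (le_abs_self c)) T.one_mem
    · rw [Algebra.algebraMap_eq_smul_one, ← add_smul]
      exact real_smul_mem T (by linarith [neg_abs_le c]) T.one_mem
  | add x y _ _ hx hy =>
    obtain ⟨N, hN, h1, h2⟩ := hx
    obtain ⟨N', hN', h1', h2'⟩ := hy
    refine ⟨N + N', add_nonneg hN hN', ?_, ?_⟩
    · convert! T.add_mem h1 h1' using 1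
      rw [add_smul]; ring
    · convert! T.add_mem h2 h2' using 1
      rw [add_smul]; ring
  | mul x y _ _ hx hy =>
    obtain ⟨N, hN, h1, h2⟩ := hx
    obtain ⟨N', hN', h1', h2'⟩ := hy
    have half : (0 : ℝ) ≤ 1 / 2 := by norm_num
    refine ⟨N * N', mul_nonneg hN hN', ?_, ?_⟩
    · convert! real_smul_mem T half (T.add_mem (T.mul_mem h1 h2') (T.mul_mem h2 h1')) using 1
      have : (N • (1 : A) - x) * (N' • (1 : A) + y) + (N • (1 : A) + x) * (N' • (1 : A) - y)
          = (2 : ℝ) • ((N * N') • (1 : A) - x * y) := by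
        simp only [Algebra.smul_def, map_mul, mul_one, map_ofNat]; ring
      rw [this, smul_smul]; norm_num
    · convert! real_smul_mem T half (T.add_mem (T.mul_mem h1 h1') (T.mul_mem h2 h2')) using 1
      have : (N • (1 : A) - x) * (N' • (1 : A) - y) + (N • (1 : A) + x) * (N' • (1 : A) + y)
          = (2 : ℝ) • ((N * N') • (1 : A) + x * y) := by
        simp only [Algebra.smul_def, map_mul, mul_one, map_ofNat]; ring
      rw [this, smul_smul]; norm_num

/-- The normalized linear functionals that are nonnegative on `T`. -/
def states (T : Subalgebra ℝ≥0 A) : Set (A → ℝ) :=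
  {L | (∀ x y, L (x + y) = L x + L y) ∧ (∀ (c : ℝ) x, L (c • x) = c * L x) ∧ L 1 = 1 ∧
    ∀ t ∈ T, 0 ≤ L t}

/-- The cone `T - ℝ≥0 f` contains no negative constant, so the functional `1 ↦ 1` on the constants
is positive for it. The archimedean property makes `1` an order unit, which is what Riesz extension
needs. -/
theorem exists_state_nonpos (T : Subalgebra ℝ≥0 A)
    (harch : ∀ p : A, ∃ N : ℝ, 0 ≤ N ∧ N • (1 : A) - p ∈ T ∧ N • (1 : A) + p ∈ T)
    {f : A} (hf : f ∉ T) : ∃ L ∈ states T, L f ≤ 0 := by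
  let s : PointedCone ℝ A :=
    { carrier := {x | ∃ t ∈ T, ∃ c : ℝ, 0 ≤ c ∧ x = t - c • f}
      add_mem' := by
        rintro _ _ ⟨t, ht, c, hc, rfl⟩ ⟨t', ht', c', hc', rfl⟩
        exact ⟨t + t', T.add_mem ht ht', c + c', add_nonneg hc hc', by rw [add_smul]; ring⟩
      zero_mem' := ⟨0, T.zero_mem, 0, le_rfl, by simp⟩
      smul_mem' := by
        rintro ⟨a, ha⟩ _ ⟨t, ht, c, hc, rfl⟩
        refine ⟨a • t, real_smul_mem T ha ht, a * c, mul_nonneg ha hc, ?_⟩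
        change a • (t - c • f) = _
        rw [smul_sub, smul_smul] }
  have hTs : ∀ t ∈ T, t ∈ s := fun t ht => ⟨t, ht, 0, le_rfl, by simp⟩
  have hneg : ∀ a : ℝ, a < 0 → a • (1 : A) ∉ s := by
    rintro a ha ⟨t, ht, c, hc, h⟩
    -- If `c = 0`, then `T` contains a negative constant, and a multiple of it cancels `N` in `N + f
    -- ∈ T`. If `c > 0`, then `c f = t + |a|` lies in `T`. Either way `f ∈ T`.
    rcases hc.eq_or_lt with rfl | hc
    · obtain ⟨N, hN, -, h2⟩ := harch f
      have ht' : a • (1 : A) ∈ T := by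
        rw [h]; simpa using ht
      apply hf
      have := T.add_mem h2 (real_smul_mem T (div_nonneg hN (neg_nonneg.2 ha.le)) ht')
      rw [smul_smul] at this
      convert! this using 1
      rw [div_neg, neg_mul, div_mul_cancel₀ _ ha.ne, neg_smul]; ring
    · apply hf
      have h3 : c • f = t + (-a) • (1 : A) := by rw [neg_smul, h]; ring
      have := real_smul_mem T (inv_nonneg.2 hc.le)
        (T.add_mem ht (real_smul_mem T (neg_nonneg.2 ha.le) T.one_mem))
      rwa [← h3, smul_smul, inv_mul_cancel₀ hc.ne', one_smul] at this
  have h1 : (1 : A) ≠ 0 := fun h => hneg (-1) (by norm_num) (by simp [h])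
  obtain ⟨L, hL, hLs⟩ := riesz_extension s (LinearPMap.mkSpanSingleton (K := ℝ) (1 : A) (1 : ℝ) h1)
    (by
      rintro ⟨x, hx⟩ hxs
      obtain ⟨a, rfl⟩ := Submodule.mem_span_singleton.1 hx
      erw [LinearPMap.mkSpanSingleton'_apply]
      by_contra! ha
      exact hneg a (by simpa using ha) hxs)
    (by
      intro y
      obtain ⟨N, -, -, h⟩ := harch y
      exact ⟨⟨N • (1 : A), Submodule.smul_mem _ _ (Submodule.mem_span_singleton_self _)⟩,
        hTs _ h⟩)
  refine ⟨L, ⟨map_add L, fun c x => by simp, ?_, fun t ht => hLs _ (hTs t ht)⟩, ?_⟩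
  · have := hL ⟨1, Submodule.mem_span_singleton_self _⟩
    rw [this]
    have h2 := LinearPMap.mkSpanSingleton_apply ℝ ℝ (σ := RingHom.id ℝ) h1 (1 : ℝ)
    exact h2
  · have := hLs (-f) ⟨0, T.zero_mem, 1, zero_le_one, by simp⟩
    rw [map_neg] at this
    linarith

/-- Tychonoff: the archimedean bounds confine `L p` to `[-N p, N p]`, and the defining conditions
are closed for pointwise convergence. -/
theorem isCompact_states (T : Subalgebra ℝ≥0 A)
    (harch : ∀ p : A, ∃ N : ℝ, 0 ≤ N ∧ N • (1 : A) - p ∈ T ∧ N • (1 : A) + p ∈ T) :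
    IsCompact (states T) := by
  choose N hN h1 h2 using harch
  refine (isCompact_univ_pi (fun p => isCompact_Icc (a := -N p) (b := N p))).of_isClosed_subset
    ?_ ?_
  · simp only [states, Set.ofPred_and, Set.ofPred_forall]
    refine IsClosed.inter ?_ (IsClosed.inter ?_ (IsClosed.inter ?_ ?_))
    · exact isClosed_iInter fun x => isClosed_iInter fun y =>
        isClosed_eq (by fun_prop) (by fun_prop)
    · exact isClosed_iInter fun x => isClosed_iInter fun y =>
        isClosed_eq (by fun_prop) (by fun_prop)
    · exact isClosed_eq (by fun_prop) (by fun_prop)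
    · exact isClosed_iInter fun x => isClosed_iInter fun _ =>
        isClosed_le (by fun_prop) (by fun_prop)
  · rintro L ⟨hadd, hsmul, hone, hpos⟩ p -
    have e1 := hpos _ (h1 p)
    have e2 := hpos _ (h2 p)
    rw [sub_eq_add_neg, ← neg_one_smul ℝ p, hadd, hsmul, hsmul, hone] at e1
    rw [hadd, hsmul, hone] at e2
    constructor <;> linarith

/-- An extreme state is multiplicative with respect to `g` if `g` and `1 - g` belong to `T`. -/
theorem map_mul_of_mem_extremePoints (T : Subalgebra ℝ≥0 A)
    (harch : ∀ p : A, ∃ N : ℝ, 0 ≤ N ∧ N • (1 : A) - p ∈ T ∧ N • (1 : A) + p ∈ T)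
    {L : A → ℝ} (hL : L ∈ Set.extremePoints ℝ (states T)) {g : A} (hg : g ∈ T)
    (hg' : 1 - g ∈ T) (p : A) : L (g * p) = L g * L p := by
  obtain ⟨⟨hadd, hsmul, hone, hpos⟩, hext⟩ := hL
  have hsub : ∀ x y, L (x - y) = L x - L y := fun x y => by
    rw [sub_eq_add_neg, ← neg_one_smul ℝ y, hadd, hsmul]; ring
  have key : ∀ u ∈ T, 0 < L u → (fun x => (L u)⁻¹ * L (u * x)) ∈ states T := by
    intro u hu hLu
    refine ⟨fun x y => ?_, fun c x => ?_, ?_, fun t ht => ?_⟩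
    · simp only [mul_add, hadd]
    · simp only [mul_smul_comm, hsmul]; ring
    · simp [hLu.ne']
    · exact mul_nonneg (inv_nonneg.2 hLu.le) (hpos _ (T.mul_mem hu ht))
  -- A Cauchy-Schwarz substitute: `u (N ± x) ∈ T` gives `± L (u x) ≥ 0` once `L u = 0`.
  have vanish : ∀ u ∈ T, L u = 0 → ∀ x, L (u * x) = 0 := by
    intro u hu hLu x
    obtain ⟨N, -, h1, h2⟩ := harch x
    have e1 := hpos _ (T.mul_mem hu h1)
    have e2 := hpos _ (T.mul_mem hu h2)
    rw [mul_sub, hsub, mul_smul_comm, hsmul, mul_one, hLu] at e1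
    rw [mul_add, hadd, mul_smul_comm, hsmul, mul_one, hLu] at e2
    linarith
  have hcompl : L (1 - g) = 1 - L g := by rw [hsub, hone]
  have hsplit : ∀ x, L ((1 - g) * x) = L x - L (g * x) := fun x => by
    rw [sub_mul, one_mul, hsub]
  rcases (hpos _ hg).eq_or_lt with h0 | h0
  · rw [vanish g hg h0.symm, ← h0, zero_mul]
  rcases (hpos _ hg').eq_or_lt with h1 | h1
  · have := vanish _ hg' h1.symm p
    rw [hsplit] at this
    rw [show L g = 1 by linarith]
    linarith
  -- `L` is the convex combination, with weights `L g` and `1 - L g`, of the states `L (g ·) / L g`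
  -- and `L ((1 - g) ·) / L (1 - g)`. Extremality makes the first of them equal to `L`.
  have h := hext (key g hg h0) (key (1 - g) hg' h1)
    ⟨L g, L (1 - g), h0, h1, by rw [hcompl]; ring, by
      funext x
      simp only [Pi.add_apply, Pi.smul_apply, smul_eq_mul, mul_inv_cancel_left₀ h0.ne',
        mul_inv_cancel_left₀ h1.ne', hsplit]
      ring⟩
  have := congrFun h p
  rw [← this, mul_inv_cancel_left₀ h0.ne']

/-- The Krivine-Kadison-Dubois representation theorem, for a subsemialgebra `T` which contains
`g` and `1 - g` for all `g` in a set of generators. -/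
theorem mem_of_forall_character_pos (T : Subalgebra ℝ≥0 A) {G : Set A}
    (hG : ∀ g ∈ G, g ∈ T ∧ 1 - g ∈ T) (hadj : Algebra.adjoin ℝ G = ⊤) {f : A}
    (hf : ∀ φ : A →ₐ[ℝ] ℝ, (∀ t ∈ T, 0 ≤ φ t) → 0 < φ f) : f ∈ T := by
  by_contra hfT
  have harch := exists_bound_of_adjoin_eq_top T hG hadj
  obtain ⟨L₀, hL₀, hL₀f⟩ := exists_state_nonpos T harch hfT
  have hcomp := isCompact_states T harch
  obtain ⟨L₁, hL₁, hmin⟩ := hcomp.exists_isMinOn ⟨L₀, hL₀⟩ (continuous_apply f).continuousOn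
  -- The states minimizing `L f` form an exposed face. By Krein-Milman it has an extreme point,
  -- which is extreme among all states and still satisfies `L f ≤ 0`.
  let l : StrongDual ℝ (A → ℝ) := -ContinuousLinearMap.proj f
  have hexp : IsExposed ℝ (states T) (l.toExposed (states T)) :=
    ContinuousLinearMap.toExposed.isExposed
  obtain ⟨L, hL⟩ := (hexp.isCompact hcomp).extremePoints_nonempty
    ⟨L₁, hL₁, fun y hy => neg_le_neg (hmin hy)⟩
  have hLf : L f ≤ 0 := by
    have := hL.1.2 L₀ hL₀
    simp only [l, neg_apply, ContinuousLinearMap.proj_apply] at this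
    linarith
  have hLe := hexp.isExtreme.extremePoints_subset_extremePoints hL
  obtain ⟨hadd, hsmul, hone, hpos⟩ := hLe.1
  have hmul : ∀ x y, L (x * y) = L x * L y := by
    intro x
    have hx : x ∈ Algebra.adjoin ℝ G := hadj ▸ Algebra.mem_top
    induction hx using Algebra.adjoin_induction with
    | mem x hx => exact map_mul_of_mem_extremePoints T harch hLe (hG x hx).1 (hG x hx).2
    | algebraMap c =>
      intro y
      rw [← Algebra.smul_def, hsmul, Algebra.algebraMap_eq_smul_one, hsmul, hone, mul_one]
    | add x x' _ _ hx hx' => intro y; rw [add_mul, hadd, hadd, hx, hx', add_mul]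
    | mul x x' _ _ hx hx' => intro y; rw [mul_assoc, hx, hx', hx, mul_assoc]
  let φ : A →ₐ[ℝ] ℝ := AlgHom.ofLinearMap ⟨⟨L, hadd⟩, hsmul⟩ hone hmul
  exact absurd (hf φ hpos) (not_lt.2 hLf)

end Positivstellensatz

/-! ### Polynomials positive on `K` as combinations of the `h_{p,q}` -/

section Handelman

open scoped NNReal

variable {n m : ℕ}

theorem sum_levelIdx_of_le {M : ℝ} {g : Fin m → MvPolynomial (Fin n) ℝ}
    {k k' : ℕ} (hk : k ≤ k') (c : (Fin m → ℕ) × (Fin m → ℕ) → ℝ) :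
    ∑ pq ∈ levelIdx m k', C (if pq ∈ levelIdx m k then c pq else 0) * hPoly M g pq
      = ∑ pq ∈ levelIdx m k, C (c pq) * hPoly M g pq := by
  have hsub : levelIdx m k ⊆ levelIdx m k' := fun pq h => by
    rw [mem_levelIdx] at h ⊢; omega
  rw [← Finset.sum_subset hsub]
  · exact Finset.sum_congr rfl fun pq h => by rw [if_pos h]
  · intro pq _ h
    rw [if_neg h, map_zero, zero_mul]

theorem hPoly_mul {M : ℝ} {g : Fin m → MvPolynomial (Fin n) ℝ}
    (a b : (Fin m → ℕ) × (Fin m → ℕ)) :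
    hPoly M g a * hPoly M g b = hPoly M g (a + b) := by
  simp only [hPoly, ← Finset.prod_mul_distrib]
  refine Finset.prod_congr rfl fun i _ => ?_
  simp only [Prod.fst_add, Prod.snd_add, Pi.add_apply, pow_add]
  ring

theorem hPoly_zero {M : ℝ} {g : Fin m → MvPolynomial (Fin n) ℝ} : hPoly M g 0 = 1 := by
  simp [hPoly]

/-- A polynomial in the semialgebra generated by `ĝᵢ` and `1 - ĝᵢ` is a nonnegative combination of
the products `h_{p,q}`. -/
theorem exists_level_of_mem_adjoin {M : ℝ} {g : Fin m → MvPolynomial (Fin n) ℝ}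
    {p : MvPolynomial (Fin n) ℝ}
    (hp : p ∈ Algebra.adjoin ℝ≥0 (Set.range (fun i => hat M (g i)) ∪
      Set.range (fun i => 1 - hat M (g i)))) :
    ∃ k, ∃ c : (Fin m → ℕ) × (Fin m → ℕ) → ℝ, (∀ pq, 0 ≤ c pq) ∧
      p = ∑ pq ∈ levelIdx m k, C (c pq) * hPoly M g pq := by
  -- The semialgebra is the `ℝ≥0`-span of the monoid generated by the `ĝᵢ` and `1 - ĝᵢ`, and that
  -- monoid consists of the `h_{p,q}`.
  rw [← Subalgebra.mem_toSubmodule, Algebra.adjoin_eq_span] at hp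
  induction hp using Submodule.span_induction with
  | mem x hx =>
    have : ∃ a, x = hPoly M g a := by
      induction hx using Submonoid.closure_induction with
      | mem x hx =>
        rcases hx with ⟨i, rfl⟩ | ⟨i, rfl⟩
        · refine ⟨(Pi.single i 1, 0), ?_⟩
          rw [hPoly, Finset.prod_eq_single i] <;> simp +contextual
        · refine ⟨(0, Pi.single i 1), ?_⟩
          rw [hPoly, Finset.prod_eq_single i] <;> simp +contextual
      | one => exact ⟨0, hPoly_zero.symm⟩
      | mul x y _ _ hx hy =>
        obtain ⟨a, rfl⟩ := hx
        obtain ⟨b, rfl⟩ := hy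
        exact ⟨a + b, hPoly_mul a b⟩
    obtain ⟨a, rfl⟩ := this
    refine ⟨∑ i, a.1 i + ∑ i, a.2 i, Pi.single a 1, ?_, ?_⟩
    · intro pq
      by_cases h : pq = a
      · subst h; simp
      · simp [h]
    · rw [Finset.sum_eq_single a]
      · simp
      · intro b _ hb; simp [hb]
      · intro h; exact absurd ((mem_levelIdx a).2 le_rfl) h
  | zero => exact ⟨0, 0, fun _ => le_rfl, by simp⟩
  | add x y _ _ hx hy =>
    obtain ⟨k, c, hc, rfl⟩ := hx
    obtain ⟨k', c', hc', rfl⟩ := hy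
    refine ⟨max k k', fun pq => (if pq ∈ levelIdx m k then c pq else 0)
      + (if pq ∈ levelIdx m k' then c' pq else 0), ?_, ?_⟩
    · intro pq
      have := hc pq
      have := hc' pq
      positivity
    · simp only [map_add, add_mul, Finset.sum_add_distrib]
      rw [sum_levelIdx_of_le (le_max_left _ _), sum_levelIdx_of_le (le_max_right _ _)]
  | smul a x _ hx =>
    obtain ⟨k, c, hc, rfl⟩ := hx
    refine ⟨k, fun pq => a * c pq, fun pq => mul_nonneg a.2 (hc pq), ?_⟩
    rw [NNReal.smul_def, Finset.smul_sum]
    refine Finset.sum_congr rfl fun pq _ => ?_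
    rw [smul_eq_C_mul, map_mul, mul_assoc]

/-- The bounded degree Positivstellensatz: a polynomial that is positive on `K` is a nonnegative
combination of the products `h_{p,q}`. -/
theorem exists_level_of_pos {M : ℝ} (hM : 0 < M) {g : Fin m → MvPolynomial (Fin n) ℝ}
    (hgen : Algebra.adjoin ℝ (insert 1 (Set.range g)) = ⊤) {p : MvPolynomial (Fin n) ℝ}
    (hp : ∀ x ∈ feasibleSet g, 0 < eval x p) :
    ∃ k, ∃ c : (Fin m → ℕ) × (Fin m → ℕ) → ℝ, (∀ pq, 0 ≤ c pq) ∧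
      p = ∑ pq ∈ levelIdx m k, C (c pq) * hPoly M g pq := by
  apply exists_level_of_mem_adjoin
  refine mem_of_forall_character_pos (G := Set.range fun i => hat M (g i)) _ ?_ ?_ ?_
  · rintro _ ⟨i, rfl⟩
    exact ⟨Algebra.subset_adjoin (Or.inl ⟨i, rfl⟩), Algebra.subset_adjoin (Or.inr ⟨i, rfl⟩)⟩
  · rw [eq_top_iff, ← hgen, Algebra.adjoin_le_iff]
    rintro _ (rfl | ⟨i, rfl⟩)
    · exact one_mem _
    · have : g i = M • hat M (g i) := by
        rw [hat, ← smul_eq_C_mul, smul_smul, mul_inv_cancel₀ hM.ne', one_smul]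
      rw [this]
      exact Subalgebra.smul_mem _ (Algebra.subset_adjoin (Set.mem_range_self i)) M
  · intro φ hφ
    -- A character of the polynomial ring is evaluation at the point `(φ (X i))ᵢ`; nonnegativity on
    -- the `ĝᵢ` puts this point in `K`.
    have hφe : ∀ q, φ q = eval (fun i => φ (X i)) q := fun q => by
      have : φ = aeval fun i => φ (X i) := by ext; simp
      conv_lhs => rw [this]
      rw [aeval_eq_eval]
    rw [hφe]
    refine hp _ fun i => ?_
    have := hφ (hat M (g i)) (Algebra.subset_adjoin (Or.inl ⟨i, rfl⟩))
    rw [hφe, hat, map_mul, eval_C] at this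
    exact nonneg_of_mul_nonneg_right this (inv_pos.2 hM)

end Handelman

/-! ### Degrees of the terms in sums of squares -/

section Degree

/-- The restriction of a polynomial to the line through the origin and `x`. -/
noncomputable def restrictLine {σ : Type*} (x : σ → ℝ) (p : MvPolynomial σ ℝ) : Polynomial ℝ :=
  ∑ i ∈ Finset.range (p.totalDegree + 1),
    Polynomial.C (eval x (homogeneousComponent i p)) * Polynomial.X ^ i

theorem eval_smul_homogeneousComponent {σ : Type*} (x : σ → ℝ) (p : MvPolynomial σ ℝ) (t : ℝ)
    (i : ℕ) : eval (t • x) (homogeneousComponent i p) =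
      eval x (homogeneousComponent i p) * t ^ i := by
  rw [homogeneousComponent_apply, map_sum, map_sum, Finset.sum_mul]
  refine Finset.sum_congr rfl fun a ha => ?_
  rw [eval_monomial, eval_monomial, ← (Finset.mem_filter.1 ha).2, mul_assoc, Finsupp.degree_apply,
    Finsupp.prod, Finsupp.prod, ← Finset.prod_pow_eq_pow_sum, ← Finset.prod_mul_distrib]
  simp only [Pi.smul_apply, smul_eq_mul, mul_pow, mul_comm]

theorem eval_restrictLine {σ : Type*} (x : σ → ℝ) (p : MvPolynomial σ ℝ) (t : ℝ) :
    (restrictLine x p).eval t = eval (t • x) p := by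
  conv_rhs => rw [← sum_homogeneousComponent p]
  simp only [restrictLine, Polynomial.eval_finsetSum, Polynomial.eval_mul, Polynomial.eval_C,
    Polynomial.eval_pow, Polynomial.eval_X, map_sum, eval_smul_homogeneousComponent]

/-- Choose `x` where the top form of `p` does not vanish. If `q` had smaller degree, `q / p` would
tend to `0` along the ray through `x`, although it is at least `1` wherever `p ≠ 0`. Applied to one
square and the whole sum, this rules out cancellation of leading terms. -/
theorem totalDegree_le_of_eval_le {σ : Type*} {p q : MvPolynomial σ ℝ}
    (h0 : ∀ x, 0 ≤ eval x p) (hle : ∀ x, eval x p ≤ eval x q) :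
    p.totalDegree ≤ q.totalDegree := by
  by_contra! hlt
  have hp0 : homogeneousComponent p.totalDegree p ≠ 0 := by
    have hne : p.support.Nonempty := by
      rw [Finset.nonempty_iff_ne_empty, Ne, MvPolynomial.support_eq_empty]
      rintro rfl
      simp at hlt
    obtain ⟨a, ha, hdeg⟩ := Finset.exists_mem_eq_sup _ hne fun s => s.sum fun _ e => e
    intro h
    have hc := congrArg (coeff a) h
    have hd : a.degree = p.totalDegree := hdeg.symm
    rw [coeff_homogeneousComponent, if_pos hd, coeff_zero] at hc
    exact (mem_support_iff.1 ha) hc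
  obtain ⟨x, hx⟩ : ∃ x, eval x (homogeneousComponent p.totalDegree p) ≠ 0 := by
    by_contra! h
    exact hp0 (MvPolynomial.funext fun x => by simpa using h x)
  have hcoeff : (restrictLine x p).coeff p.totalDegree ≠ 0 := by
    simpa [restrictLine, Polynomial.finsetSum_coeff, Polynomial.coeff_X_pow] using hx
  have hne : restrictLine x p ≠ 0 := fun h => hcoeff (by rw [h, Polynomial.coeff_zero])
  have hdeg : (restrictLine x q).degree < (restrictLine x p).degree := by
    refine lt_of_lt_of_le ?_ (Polynomial.le_degree_of_ne_zero hcoeff)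
    refine lt_of_le_of_lt (Polynomial.degree_sum_le _ _) ?_
    rw [Finset.sup_lt_iff (by exact WithBot.bot_lt_coe _)]
    intro i hi
    refine lt_of_le_of_lt (Polynomial.degree_C_mul_X_pow_le _ _) ?_
    have := Finset.mem_range.1 hi
    exact_mod_cast (by omega : i < p.totalDegree)
  have htend := (Polynomial.div_tendsto_atTop_zero_iff_degree_lt _ _ hne).2 hdeg
  have hev : ∀ᶠ t : ℝ in atTop, (restrictLine x p).eval t ≠ 0 :=
    Polynomial.eventually_atTop_not_isRoot _ hne
  have : (1 : ℝ) ≤ 0 := by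
    refine ge_of_tendsto htend ?_
    filter_upwards [hev] with t ht
    rw [eval_restrictLine] at ht
    rw [eval_restrictLine, eval_restrictLine, one_le_div (lt_of_le_of_ne (h0 _) ht.symm)]
    exact hle _
  linarith

theorem totalDegree_le_of_sq_le {σ : Type*} {q : MvPolynomial σ ℝ} {u : ℕ}
    (h : (q * q).totalDegree ≤ 2 * u) : q.totalDegree ≤ u := by
  by_cases hq : q = 0
  · simp [hq]
  · rw [totalDegree_mul_of_isDomain hq hq] at h
    omega

theorem IsSumSq.eval_nonneg {σ : Type*} {s : MvPolynomial σ ℝ} (hs : IsSumSq s) (x : σ → ℝ) :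
    0 ≤ eval x s := by
  induction hs with
  | zero => simp
  | sq_add a _ ih =>
    rw [map_add, map_mul]
    exact add_nonneg (mul_self_nonneg _) ih

/-- A linear functional that is nonnegative on squares of degree at most `2 u` is nonnegative on
sums of squares of degree at most `2 u`. -/
theorem IsSumSq.map_nonneg_of_totalDegree_le {σ : Type*} {u : ℕ} (L : MvPolynomial σ ℝ →ₗ[ℝ] ℝ)
    (hL : ∀ q : MvPolynomial σ ℝ, q.totalDegree ≤ u → 0 ≤ L (q * q)) {s : MvPolynomial σ ℝ}
    (hs : IsSumSq s) (hdeg : s.totalDegree ≤ 2 * u) : 0 ≤ L s := by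
  induction hs with
  | zero => simp
  | sq_add a hs ih =>
    rw [map_add]
    refine add_nonneg (hL _ (totalDegree_le_of_sq_le (le_trans ?_ hdeg))) (ih (le_trans ?_ hdeg))
    · refine totalDegree_le_of_eval_le (fun x => ?_) fun x => ?_
      · rw [map_mul]; exact mul_self_nonneg _
      · rw [map_add]; linarith [IsSumSq.eval_nonneg hs x]
    · refine totalDegree_le_of_eval_le (IsSumSq.eval_nonneg hs) fun x => ?_
      rw [map_add, map_mul]; linarith [mul_self_nonneg (eval x a)]

/-- The degree of the square controls only exponents with nonzero coefficient, and `a ≠ b` prevents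
cancellation between the two terms. An exponent with zero coefficient may be too large for `hL`, so
it is replaced by the other one. -/
theorem map_binomial_sq_nonneg {n u : ℕ} (L : MvPolynomial (Fin n) ℝ →ₗ[ℝ] ℝ)
    (hL : ∀ (a b : Fin n →₀ ℕ) (β γ : ℝ), a.degree ≤ u → b.degree ≤ u →
      0 ≤ L ((monomial a β + monomial b γ) ^ 2)) {a b : Fin n →₀ ℕ} (hab : a ≠ b) (β γ : ℝ)
    (hdeg : ((monomial a β + monomial b γ : MvPolynomial (Fin n) ℝ) ^ 2).totalDegree ≤ 2 * u) :
    0 ≤ L ((monomial a β + monomial b γ) ^ 2) := by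
  have hd : (monomial a β + monomial b γ : MvPolynomial (Fin n) ℝ).totalDegree ≤ u :=
    totalDegree_le_of_sq_le (by rwa [← sq])
  have ha : β ≠ 0 → a.degree ≤ u := fun h => by
    refine le_trans (le_totalDegree (p := monomial a β + monomial b γ) ?_) hd
    simpa [mem_support_iff, coeff_monomial, hab.symm] using h
  have hb : γ ≠ 0 → b.degree ≤ u := fun h => by
    refine le_trans (le_totalDegree (p := monomial a β + monomial b γ) ?_) hd
    simpa [mem_support_iff, coeff_monomial, hab] using h
  by_cases hβ : β = 0
  · by_cases hγ : γ = 0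
    · simp [hβ, hγ]
    · simpa [hβ] using hL b b 0 γ (hb hγ) (hb hγ)
  · by_cases hγ : γ = 0
    · simpa [hγ] using hL a a β 0 (ha hβ) (ha hβ)
    · exact hL a b β γ (ha hβ) (hb hγ)

/-- A linear functional that is nonnegative on squares of binomials of degree at most `2 u` is
nonnegative on scaled diagonally dominant sums of squares of degree at most `2 u`. -/
theorem IsSDSOS.map_nonneg_of_totalDegree_le {n u : ℕ} (L : MvPolynomial (Fin n) ℝ →ₗ[ℝ] ℝ)
    (hL : ∀ (a b : Fin n →₀ ℕ) (β γ : ℝ), a.degree ≤ u → b.degree ≤ u →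
      0 ≤ L ((monomial a β + monomial b γ) ^ 2)) {s : MvPolynomial (Fin n) ℝ}
    (hs : IsSDSOS s) (hdeg : s.totalDegree ≤ 2 * u) : 0 ≤ L s := by
  obtain ⟨S, α, βp, γp, βm, γm, hα, -, hs⟩ := hs
  -- Absorbing `α` under the square, and the minus sign into `γ⁻`, makes every term the square of a
  -- monomial or binomial.
  have e1 : ∀ a, C (α a) * monomial a (1 : ℝ) ^ 2 = monomial a √(α a) ^ 2 := fun a => by
    have : monomial a √(α a) = C √(α a) * monomial a 1 := by rw [C_mul_monomial, mul_one]
    rw [this, mul_pow, ← C_pow, Real.sq_sqrt (hα a)]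
  simp only [e1, C_mul_monomial, mul_one, sub_eq_add_neg (monomial _ _), ← map_neg] at hs
  have hev : ∀ x, eval x s = ∑ a ∈ S, (eval x (monomial a √(α a))) ^ 2
      + ∑ e ∈ S.offDiag, (eval x (monomial e.1 (βp e.1 e.2) + monomial e.2 (γp e.1 e.2))) ^ 2
      + ∑ e ∈ S.offDiag, (eval x (monomial e.1 (βm e.1 e.2) + monomial e.2 (-γm e.1 e.2))) ^ 2 := by
    intro x
    rw [hs]
    simp only [map_add, map_sum, map_pow]
  have n1 : ∀ x, 0 ≤ ∑ a ∈ S, (eval x (monomial a √(α a))) ^ 2 :=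
    fun x => Finset.sum_nonneg fun _ _ => sq_nonneg _
  have n2 : ∀ x, 0 ≤ ∑ e ∈ S.offDiag,
      (eval x (monomial e.1 (βp e.1 e.2) + monomial e.2 (γp e.1 e.2))) ^ 2 :=
    fun x => Finset.sum_nonneg fun _ _ => sq_nonneg _
  have n3 : ∀ x, 0 ≤ ∑ e ∈ S.offDiag,
      (eval x (monomial e.1 (βm e.1 e.2) + monomial e.2 (-γm e.1 e.2))) ^ 2 :=
    fun x => Finset.sum_nonneg fun _ _ => sq_nonneg _
  rw [hs, map_add, map_add, map_sum, map_sum, map_sum]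
  refine add_nonneg (add_nonneg ?_ ?_) ?_
  · refine Finset.sum_nonneg fun a ha => ?_
    have hd : (monomial a √(α a) : MvPolynomial (Fin n) ℝ).totalDegree ≤ u := by
      refine totalDegree_le_of_sq_le (le_trans (totalDegree_le_of_eval_le (fun x => ?_)
        fun x => ?_) hdeg)
      · rw [map_mul]; exact mul_self_nonneg _
      · rw [map_mul, ← sq, hev]
        have := Finset.single_le_sum (f := fun a => (eval x (monomial a √(α a))) ^ 2)
          (fun _ _ => sq_nonneg _) ha
        linarith [n2 x, n3 x]
    by_cases h0 : √(α a) = 0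
    · simp [h0]
    · rw [totalDegree_monomial _ h0] at hd
      simpa using hL a a √(α a) 0 hd hd
  · refine Finset.sum_nonneg fun e he => ?_
    refine map_binomial_sq_nonneg L hL (Finset.mem_offDiag.1 he).2.2 _ _
      (le_trans (totalDegree_le_of_eval_le (fun x => ?_) fun x => ?_) hdeg)
    · rw [map_pow]; exact sq_nonneg _
    · rw [map_pow, hev]
      have := Finset.single_le_sum (f := fun e : (Fin n →₀ ℕ) × (Fin n →₀ ℕ) =>
        (eval x (monomial e.1 (βp e.1 e.2) + monomial e.2 (γp e.1 e.2))) ^ 2)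
        (fun _ _ => sq_nonneg _) he
      linarith [n1 x, n3 x]
  · refine Finset.sum_nonneg fun e he => ?_
    refine map_binomial_sq_nonneg L hL (Finset.mem_offDiag.1 he).2.2 _ _
      (le_trans (totalDegree_le_of_eval_le (fun x => ?_) fun x => ?_) hdeg)
    · rw [map_pow]; exact sq_nonneg _
    · rw [map_pow, hev]
      have := Finset.single_le_sum (f := fun e : (Fin n →₀ ℕ) × (Fin n →₀ ℕ) =>
        (eval x (monomial e.1 (βm e.1 e.2) + monomial e.2 (-γm e.1 e.2))) ^ 2)
        (fun _ _ => sq_nonneg _) he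
      linarith [n1 x, n2 x]

end Degree

/-! ### The Riesz functional and Dirac moments -/

section Riesz

variable {n D : ℕ}

theorem riesz_add (y : MIdx n D → ℝ) (p q : MvPolynomial (Fin n) ℝ) :
    riesz y (p + q) = riesz y p + riesz y q := by
  simp [riesz, add_mul, Finset.sum_add_distrib]

theorem riesz_smul (y : MIdx n D → ℝ) (c : ℝ) (p : MvPolynomial (Fin n) ℝ) :
    riesz y (c • p) = c * riesz y p := by
  simp [riesz, mul_assoc, Finset.mul_sum]

/-- The Riesz functional as a linear map. -/
noncomputable def rieszHom (y : MIdx n D → ℝ) : MvPolynomial (Fin n) ℝ →ₗ[ℝ] ℝ where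
  toFun := riesz y
  map_add' := riesz_add y
  map_smul' := riesz_smul y

theorem rieszHom_apply (y : MIdx n D → ℝ) (p : MvPolynomial (Fin n) ℝ) :
    rieszHom y p = riesz y p := rfl

theorem riesz_C (y : MIdx n D → ℝ) (c : ℝ) : riesz y (C c) = c * y ⟨0, by simp⟩ := by
  rw [riesz, Finset.sum_eq_single ⟨0, by simp⟩]
  · simp
  · intro b _ hb
    rw [coeff_C, if_neg, zero_mul]
    intro h
    exact hb (Subtype.ext h.symm)
  · simp

theorem degree_le_totalDegree {p : MvPolynomial (Fin n) ℝ} {a : Fin n →₀ ℕ} (ha : coeff a p ≠ 0) :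
    a.degree ≤ p.totalDegree :=
  le_totalDegree (mem_support_iff.2 ha)

theorem riesz_eq_of_forall_degree_le {D' : ℕ} {y : MIdx n D → ℝ} {y' : MIdx n D' → ℝ}
    {p : MvPolynomial (Fin n) ℝ} (hD : p.totalDegree ≤ D) (hD' : p.totalDegree ≤ D')
    (h : ∀ a (h : a.degree ≤ D) (h' : a.degree ≤ D'), y ⟨a, h⟩ = y' ⟨a, h'⟩) :
    riesz y p = riesz y' p := by
  refine Finset.sum_bij_ne_zero (fun a _ ha => ⟨a.1, (degree_le_totalDegree
    (left_ne_zero_of_mul ha)).trans hD'⟩) ?_ ?_ ?_ ?_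
  · simp
  · intro a _ _ b _ _ hab
    exact Subtype.ext (congrArg (fun z : MIdx n D' => z.1) hab)
  · intro b _ hb
    have hbD := (degree_le_totalDegree (left_ne_zero_of_mul hb)).trans hD
    exact ⟨⟨b.1, hbD⟩, Finset.mem_univ _, by rw [h b.1 hbD b.2]; exact hb, rfl⟩
  · intro a _ ha
    exact congrArg (coeff a.1 p * ·) (h a.1 a.2 _)

/-- The moments of the Dirac measure at `x`. -/
noncomputable def diracMoments (D : ℕ) (x : Fin n → ℝ) : MIdx n D → ℝ :=
  fun a => eval x (monomial a.1 1)

theorem riesz_diracMoments {p : MvPolynomial (Fin n) ℝ} (hp : p.totalDegree ≤ D)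
    (x : Fin n → ℝ) : riesz (diracMoments D x) p = eval x p := by
  conv_rhs => rw [p.as_sum, map_sum]
  symm
  refine Finset.sum_bij_ne_zero (fun a ha _ => ⟨a, (le_totalDegree ha).trans hp⟩) ?_ ?_ ?_ ?_
  · simp
  · intro a _ _ b _ _ hab
    exact congrArg (fun z : MIdx _ _ => z.1) hab
  · intro b _ hb
    have h : monomial b.1 (coeff b.1 p) = C (coeff b.1 p) * monomial b.1 1 := by
      rw [C_mul_monomial, mul_one]
    refine ⟨b.1, mem_support_iff.2 (left_ne_zero_of_mul hb), ?_, rfl⟩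
    rw [h, map_mul, eval_C]
    exact hb
  · intro a _ _
    simp [diracMoments, eval_monomial]

end Riesz

/-! ### Matrix conditions as nonnegativity of the Riesz functional on squares -/

section Moment

variable {n D : ℕ}

open scoped Classical in
theorem sum_monomial_coeff_eq {u : ℕ} {V : Set (Fin n)} {p : MvPolynomial (Fin n) ℝ}
    (hu : p.totalDegree ≤ u) (hV : ∀ a ∈ p.support, (a.support : Set (Fin n)) ⊆ V) :
    p = ∑ a : {a : MIdx n u // (a.1.support : Set (Fin n)) ⊆ V},
      monomial a.1.1 (coeff a.1.1 p) := by
  conv_lhs => rw [p.as_sum]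
  refine Finset.sum_bij_ne_zero (fun a ha _ => ⟨⟨a, (le_totalDegree ha).trans hu⟩, hV a ha⟩)
    ?_ ?_ ?_ ?_
  · simp
  · intro a _ _ b _ _ hab
    exact congrArg (fun a => a.1.1) hab
  · intro b _ hb
    refine ⟨b.1.1, ?_, hb, rfl⟩
    rw [mem_support_iff]
    intro h
    exact hb (by rw [h, map_zero])
  · intro a _ _
    rfl

open scoped Classical in
theorem riesz_sum_monomial_sq {u : ℕ} {V : Set (Fin n)} (y : MIdx n D → ℝ)
    (v : {a : MIdx n u // (a.1.support : Set (Fin n)) ⊆ V} → ℝ) :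
    riesz y ((∑ a, monomial a.1.1 (v a)) * ∑ a, monomial a.1.1 (v a))
      = v ⬝ᵥ (momentSubmatrix u V y).mulVec v := by
  rw [← rieszHom_apply, Finset.sum_mul_sum, map_sum]
  simp only [map_sum, dotProduct, Matrix.mulVec, Finset.mul_sum]
  refine Finset.sum_congr rfl fun a _ => Finset.sum_congr rfl fun b _ => ?_
  have : ∀ (a : Fin n →₀ ℕ) (c : ℝ), monomial a c = c • monomial a 1 := fun a c => by
    rw [smul_monomial, smul_eq_mul, mul_one]
  rw [this a.1.1 (v a), this b.1.1 (v b), smul_mul_smul_comm, map_smul]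
  simp only [momentSubmatrix, momentMatrix, Matrix.submatrix_apply, Matrix.of_apply, smul_eq_mul,
    rieszHom_apply]
  ring

theorem support_mapDomain_subset_range {k l : ℕ} (e : Fin k → Fin l) (a : Fin k →₀ ℕ) :
    ((a.mapDomain e).support : Set (Fin l)) ⊆ Set.range e := by
  classical
  intro i hi
  obtain ⟨j, -, rfl⟩ := Finset.mem_image.1 (Finsupp.mapDomain_support hi)
  exact ⟨j, rfl⟩

/-- The quadratic form of the submatrix at a coefficient vector is `L_y(q²)`. Exponents supported in
the range of `e` correspond to exponents in the `k` variables, by `Finsupp.mapDomain` and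
`Finsupp.comapDomain`. -/
theorem posSemidef_momentSubmatrix_iff {k u : ℕ} {e : Fin k → Fin n} (he : Function.Injective e)
    (y : MIdx n D → ℝ) :
    (momentSubmatrix u (Set.range e) y).PosSemidef ↔
      ∀ q : MvPolynomial (Fin k) ℝ, q.totalDegree ≤ u → 0 ≤ riesz y (rename e (q * q)) := by
  classical
  rw [Matrix.posSemidef_iff_dotProduct_mulVec]
  constructor
  · rintro ⟨-, h⟩ q hq
    have hq' := sum_monomial_coeff_eq (V := Set.range e) ((totalDegree_rename_le e q).trans hq) (by
      intro a ha
      rw [support_rename_of_injective he] at ha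
      obtain ⟨b, -, rfl⟩ := Finset.mem_image.1 ha
      exact support_mapDomain_subset_range e b)
    rw [map_mul, hq', riesz_sum_monomial_sq]
    simpa using h _
  · intro h
    refine ⟨?_, fun v => ?_⟩
    · ext a b
      exact congrArg (riesz y) (mul_comm _ _)
    · have hq : rename e (∑ a, monomial (Finsupp.comapDomain e a.1.1 he.injOn) (v a))
          = ∑ a, monomial a.1.1 (v a) := by
        rw [map_sum]
        refine Finset.sum_congr rfl fun a _ => ?_
        rw [rename_monomial, Finsupp.mapDomain_comapDomain e he _ a.2]
      have := h (∑ a, monomial (Finsupp.comapDomain e a.1.1 he.injOn) (v a)) (by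
        refine totalDegree_finsetSum_le fun a _ => (totalDegree_monomial_le _ _).trans ?_
        refine le_trans (le_of_eq ?_) a.1.2
        conv_rhs => rw [← Finsupp.mapDomain_comapDomain e he _ a.2, Finsupp.degree_mapDomain]
        rfl)
      rw [map_mul, hq, riesz_sum_monomial_sq] at this
      simpa using this

theorem norm_le_add_iff {a b c : ℝ} :
    ‖!₂[2 * b, a - c]‖ ≤ a + c ↔ 0 ≤ a + c ∧ b ^ 2 ≤ a * c := by
  rw [EuclideanSpace.norm_eq, Real.sqrt_le_iff]
  simp only [Fin.sum_univ_two, Real.norm_eq_abs, sq_abs, Matrix.cons_val_zero,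
    Matrix.cons_val_one]
  refine and_congr_right fun _ => ⟨fun h => by nlinarith, fun h => by nlinarith⟩

/-- Squaring turns the cone condition into `Qᵢⱼ² ≤ Qᵢᵢ Qⱼⱼ` with nonnegative trace: each `2 × 2`
principal block is positive semidefinite. -/
theorem soCondition_iff {ι : Type} {Q : Matrix ι ι ℝ} :
    SOCondition Q ↔
      ∀ i j, ∀ β γ : ℝ, 0 ≤ β ^ 2 * Q i i + 2 * β * γ * Q i j + γ ^ 2 * Q j j := by
  simp only [SOCondition, norm_le_add_iff]
  constructor
  · intro h i j β γ
    have hi : 0 ≤ Q i i := by linarith [(h i i).1]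
    have hj : 0 ≤ Q j j := by linarith [(h j j).1]
    have hij := (h i j).2
    rcases hi.eq_or_lt with h0 | h0
    · have : Q i j = 0 := by
        rw [← h0, zero_mul] at hij
        exact pow_eq_zero_iff two_ne_zero |>.1 (le_antisymm hij (sq_nonneg _))
      rw [← h0, this]
      have := mul_nonneg (sq_nonneg γ) hj
      linarith
    · refine nonneg_of_mul_nonneg_right (a := Q i i) ?_ h0
      have : Q i i * (β ^ 2 * Q i i + 2 * β * γ * Q i j + γ ^ 2 * Q j j)
          = (Q i i * β + γ * Q i j) ^ 2 + γ ^ 2 * (Q i i * Q j j - Q i j ^ 2) := by ring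
      rw [this]
      exact add_nonneg (sq_nonneg _) (mul_nonneg (sq_nonneg _) (sub_nonneg.2 hij))
  · intro h i j
    have hi : 0 ≤ Q i i := by simpa using h i j 1 0
    have hj : 0 ≤ Q j j := by simpa using h i j 0 1
    refine ⟨add_nonneg hi hj, ?_⟩
    rcases hi.eq_or_lt with h0 | h0
    -- With `Qᵢᵢ = 0` the form takes the value `-(Qⱼⱼ + 2) Qᵢⱼ²` here, which forces `Qᵢⱼ = 0`.
    · have h1 := h i j (-(Q j j + 1)) (Q i j)
      rw [← h0] at h1 ⊢
      nlinarith [sq_nonneg (Q i j), mul_nonneg hj (sq_nonneg (Q i j))]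
    -- At these coefficients the form equals `Qᵢᵢ` times the determinant of the block.
    · have h1 := h i j (-Q i j) (Q i i)
      have h2 : 0 ≤ Q i i * (Q i i * Q j j - Q i j ^ 2) := by nlinarith
      linarith [nonneg_of_mul_nonneg_right h2 h0]

theorem soCondition_momentSubmatrix_iff {k u : ℕ} {e : Fin k → Fin n} (he : Function.Injective e)
    (y : MIdx n D → ℝ) :
    SOCondition (momentSubmatrix u (Set.range e) y) ↔
      ∀ (a b : Fin k →₀ ℕ) (β γ : ℝ), a.degree ≤ u → b.degree ≤ u →
        0 ≤ riesz y (rename e ((monomial a β + monomial b γ) ^ 2)) := by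
  have key : ∀ (a b : {a : MIdx n u // (a.1.support : Set (Fin n)) ⊆ Set.range e}) (β γ : ℝ),
      riesz y ((monomial a.1.1 β + monomial b.1.1 γ) ^ 2)
        = β ^ 2 * momentSubmatrix u (Set.range e) y a a
          + 2 * β * γ * momentSubmatrix u (Set.range e) y a b
          + γ ^ 2 * momentSubmatrix u (Set.range e) y b b := by
    intro a b β γ
    have hm : ∀ (a : Fin n →₀ ℕ) (c : ℝ), monomial a c = C c * monomial a 1 := fun a c => by
      rw [C_mul_monomial, mul_one]
    have : (monomial a.1.1 β + monomial b.1.1 γ : MvPolynomial (Fin n) ℝ) ^ 2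
        = (β ^ 2) • (monomial a.1.1 1 * monomial a.1.1 1)
          + (2 * β * γ) • (monomial a.1.1 1 * monomial b.1.1 1)
          + (γ ^ 2) • (monomial b.1.1 1 * monomial b.1.1 1) := by
      rw [hm a.1.1 β, hm b.1.1 γ]
      simp only [smul_eq_C_mul, C_mul, C_pow, map_ofNat]
      ring
    rw [this, riesz_add, riesz_add, riesz_smul, riesz_smul, riesz_smul]
    rfl
  rw [soCondition_iff]
  constructor
  · intro h a b β γ ha hb
    rw [map_pow, map_add, rename_monomial, rename_monomial]
    have := key ⟨⟨a.mapDomain e, by rwa [Finsupp.degree_mapDomain]⟩,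
      support_mapDomain_subset_range e a⟩ ⟨⟨b.mapDomain e, by rwa [Finsupp.degree_mapDomain]⟩,
      support_mapDomain_subset_range e b⟩ β γ
    dsimp only at this
    rw [this]
    exact h _ _ β γ
  · intro h a b β γ
    have h1 : ∀ a : {a : MIdx n u // (a.1.support : Set (Fin n)) ⊆ Set.range e},
        (Finsupp.comapDomain e a.1.1 he.injOn).degree ≤ u := fun a => by
      rw [← Finsupp.degree_mapDomain e, Finsupp.mapDomain_comapDomain e he _ a.2]
      exact a.1.2
    have := h _ _ β γ (h1 a) (h1 b)
    rw [map_pow, map_add, rename_monomial, rename_monomial,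
      Finsupp.mapDomain_comapDomain e he _ a.2, Finsupp.mapDomain_comapDomain e he _ b.2,
      key] at this
    exact this

end Moment

/-! ### Weak duality, monotonicity and the lower bound for the limit -/

section WeakDuality

variable {n₁ n₂ m d r k : ℕ} {f : MvPolynomial (Fin (n₁ + n₂)) ℝ}
  {g : Fin m → MvPolynomial (Fin (n₁ + n₂)) ℝ} {M : ℝ}

/-- Dual feasibility is nonnegativity on the generators of the primal cone. -/
theorem mem_feasDRP_iff {y : MIdx (n₁ + n₂) (max (k * d) r) → ℝ} :
    y ∈ feasDRP n₁ n₂ g M d r k ↔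
      (∀ pq ∈ levelIdx m k, 0 ≤ riesz y (hPoly M g pq)) ∧
      y ⟨0, by simp⟩ = 1 ∧
      (∀ q : MvPolynomial (Fin n₁) ℝ, q.totalDegree ≤ r / 2 →
        0 ≤ riesz y (rename (Fin.castAdd n₂) (q * q))) ∧
      ∀ (a b : Fin n₂ →₀ ℕ) (β γ : ℝ), a.degree ≤ r / 2 → b.degree ≤ r / 2 →
        0 ≤ riesz y (rename (Fin.natAdd n₁) ((monomial a β + monomial b γ) ^ 2)) := by
  rw [← posSemidef_momentSubmatrix_iff (Fin.castAdd_injective n₁ n₂),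
    ← soCondition_momentSubmatrix_iff (Fin.natAdd_injective n₂ n₁)]
  rfl

theorem totalDegree_hPoly_le (hg : ∀ i, (g i).totalDegree ≤ d)
    {pq : (Fin m → ℕ) × (Fin m → ℕ)} (hpq : pq ∈ levelIdx m k) :
    (hPoly M g pq).totalDegree ≤ k * d := by
  have h1 : ∀ i, (hat M (g i)).totalDegree ≤ d := fun i => by
    rw [hat, ← smul_eq_C_mul]
    exact (totalDegree_smul_le _ _).trans (hg i)
  have h2 : ∀ i, (1 - hat M (g i)).totalDegree ≤ d := fun i =>
    (totalDegree_sub _ _).trans (by simpa using h1 i)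
  refine (totalDegree_finsetProd _ _).trans ?_
  refine le_trans (Finset.sum_le_sum (g := fun i => (pq.1 i + pq.2 i) * d) fun i _ => ?_) ?_
  · refine (totalDegree_mul _ _).trans ?_
    rw [add_mul]
    exact add_le_add ((totalDegree_pow _ _).trans (Nat.mul_le_mul_left _ (h1 i)))
      ((totalDegree_pow _ _).trans (Nat.mul_le_mul_left _ (h2 i)))
  · rw [← Finset.sum_mul, Finset.sum_add_distrib]
    exact Nat.mul_le_mul_right _ ((mem_levelIdx pq).1 hpq)

theorem totalDegree_rename_mul_self_le {i j : ℕ} (e : Fin i → Fin j)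
    {q : MvPolynomial (Fin i) ℝ} (hq : q.totalDegree ≤ r / 2) :
    (rename e (q * q)).totalDegree ≤ r :=
  (totalDegree_rename_le _ _).trans ((totalDegree_mul _ _).trans (by omega))

theorem totalDegree_binomial_le {i u : ℕ} {a b : Fin i →₀ ℕ} (β γ : ℝ) (ha : a.degree ≤ u)
    (hb : b.degree ≤ u) :
    (monomial a β + monomial b γ : MvPolynomial (Fin i) ℝ).totalDegree ≤ u :=
  (totalDegree_add _ _).trans (max_le ((totalDegree_monomial_le _ _).trans ha)
    ((totalDegree_monomial_le _ _).trans hb))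

theorem le_riesz_of_mem_feas (hr : Even r) {μ : ℝ} (hμ : μ ∈ feasRP n₁ n₂ f g M r k)
    {y : MIdx (n₁ + n₂) (max (k * d) r) → ℝ} (hy : y ∈ feasDRP n₁ n₂ g M d r k) :
    μ ≤ riesz y f := by
  obtain ⟨hh, h1, hsos, hsd⟩ := mem_feasDRP_iff.1 hy
  obtain ⟨c, hc, σ₁, ⟨hσ₁, hdeg₁, -⟩, σ₂, ⟨hσ₂, hdeg₂, -⟩, heq⟩ := hμ
  -- Evenness of `r` matters here: the moment matrices of order `r / 2` must reach all squares of
  -- degree up to `r`.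
  have hr2 : 2 * (r / 2) = r := Nat.two_mul_div_two_of_even hr
  have hL₁ := IsSumSq.map_nonneg_of_totalDegree_le
    ((rieszHom y).comp (rename (R := ℝ) (Fin.castAdd n₂ : Fin n₁ → Fin (n₁ + n₂))).toLinearMap) (u := r / 2)
    (fun q hq => hsos q hq) hσ₁ (by rwa [hr2])
  have hL₂ := IsSDSOS.map_nonneg_of_totalDegree_le
    ((rieszHom y).comp (rename (R := ℝ) (Fin.natAdd n₁ : Fin n₂ → Fin (n₁ + n₂))).toLinearMap) (u := r / 2)
    (fun a b β γ ha hb => hsd a b β γ ha hb) hσ₂ (by rwa [hr2])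
  have hf : f = C μ + ∑ pq ∈ levelIdx m k, C (c pq) * hPoly M g pq
      + (rename (Fin.castAdd n₂) σ₁ + rename (Fin.natAdd n₁) σ₂) := by
    rw [← heq]; ring
  have hsum : 0 ≤ rieszHom y (∑ pq ∈ levelIdx m k, C (c pq) * hPoly M g pq) := by
    rw [map_sum]
    refine Finset.sum_nonneg fun pq hpq => ?_
    rw [← smul_eq_C_mul, map_smul]
    exact mul_nonneg (hc pq) (hh pq hpq)
  have hμ' : rieszHom y (C μ) = μ := by rw [rieszHom_apply, riesz_C, h1, mul_one]
  rw [← rieszHom_apply, hf, map_add, map_add, map_add, hμ']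
  simp only [LinearMap.comp_apply, AlgHom.toLinearMap_apply] at hL₁ hL₂
  linarith

theorem valRP_le_valDRP (hr : Even r) :
    valRP n₁ n₂ f g M r k ≤ valDRP n₁ n₂ f g M d r k :=
  iSup₂_le fun _ hμ => le_iInf₂ fun _ hy =>
    EReal.coe_le_coe_iff.2 (le_riesz_of_mem_feas hr hμ hy)

theorem feasRP_mono {k' : ℕ} (hk : k ≤ k') :
    feasRP n₁ n₂ f g M r k ⊆ feasRP n₁ n₂ f g M r k' := by
  rintro μ ⟨c, hc, σ₁, hσ₁, σ₂, hσ₂, heq⟩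
  refine ⟨fun pq => if pq ∈ levelIdx m k then c pq else 0, fun pq => ?_, σ₁, hσ₁, σ₂, hσ₂, ?_⟩
  · dsimp only
    split_ifs
    exacts [hc pq, le_rfl]
  · rw [sum_levelIdx_of_le hk, heq]

theorem valRP_mono {k' : ℕ} (hk : k ≤ k') :
    valRP n₁ n₂ f g M r k ≤ valRP n₁ n₂ f g M r k' :=
  biSup_mono fun _ h => feasRP_mono hk h

/-- Truncating a level `k + 1` moment vector gives a level `k` one. All polynomials tested have
degree at most `max (k * d) r`, so the Riesz functional does not change on them; `1 ≤ k` ensures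
this for `f`. -/
theorem valDRP_le_succ (hf : f.totalDegree ≤ d) (hg : ∀ i, (g i).totalDegree ≤ d) (hk : 1 ≤ k) :
    valDRP n₁ n₂ f g M d r k ≤ valDRP n₁ n₂ f g M d r (k + 1) := by
  have hD : max (k * d) r ≤ max ((k + 1) * d) r :=
    max_le_max_right _ (Nat.mul_le_mul_right _ (Nat.le_succ k))
  refine le_iInf₂ fun y hy => ?_
  let z : MIdx (n₁ + n₂) (max (k * d) r) → ℝ := fun a => y ⟨a.1, a.2.trans hD⟩
  have hz : ∀ p : MvPolynomial (Fin (n₁ + n₂)) ℝ, p.totalDegree ≤ max (k * d) r →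
      riesz z p = riesz y p := fun p hp =>
    riesz_eq_of_forall_degree_le hp (hp.trans hD) fun _ _ _ => rfl
  have hfD : f.totalDegree ≤ max (k * d) r :=
    hf.trans ((Nat.le_mul_of_pos_left d hk).trans (le_max_left _ _))
  obtain ⟨hh, h1, hsos, hsd⟩ := mem_feasDRP_iff.1 hy
  rw [← hz f hfD]
  refine iInf₂_le z (mem_feasDRP_iff.2 ⟨fun pq hpq => ?_, h1, fun q hq => ?_, ?_⟩)
  · rw [hz _ ((totalDegree_hPoly_le hg hpq).trans (le_max_left _ _))]
    refine hh pq ?_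
    rw [mem_levelIdx] at hpq ⊢
    omega
  · rw [hz _ ((totalDegree_rename_mul_self_le _ hq).trans (le_max_right _ _))]
    exact hsos q hq
  · intro a b β γ ha hb
    rw [hz _ ((sq (monomial a β + monomial b γ) ▸ totalDegree_rename_mul_self_le _
      (totalDegree_binomial_le β γ ha hb)).trans (le_max_right _ _))]
    exact hsd a b β γ ha hb

theorem eval_hPoly_nonneg (hM : 0 < M) {x : Fin (n₁ + n₂) → ℝ} (hx : ∀ i, 0 ≤ eval x (g i))
    (hx' : ∀ i, eval x (g i) ≤ M) (pq : (Fin m → ℕ) × (Fin m → ℕ)) :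
    0 ≤ eval x (hPoly M g pq) := by
  rw [hPoly, map_prod]
  refine Finset.prod_nonneg fun i _ => ?_
  simp only [hat, map_mul, map_pow, map_sub, map_one, eval_C]
  refine mul_nonneg (pow_nonneg (mul_nonneg (inv_nonneg.2 hM.le) (hx i)) _) (pow_nonneg ?_ _)
  rw [sub_nonneg, inv_mul_le_iff₀ hM, mul_one]
  exact hx' i

theorem diracMoments_mem_feasDRP (hg : ∀ i, (g i).totalDegree ≤ d) (hM : 0 < M)
    {x : Fin (n₁ + n₂) → ℝ} (hx : ∀ i, 0 ≤ eval x (g i)) (hx' : ∀ i, eval x (g i) ≤ M) :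
    diracMoments (max (k * d) r) x ∈ feasDRP n₁ n₂ g M d r k := by
  refine mem_feasDRP_iff.2 ⟨fun pq hpq => ?_, by simp [diracMoments], fun q hq => ?_, ?_⟩
  · rw [riesz_diracMoments ((totalDegree_hPoly_le hg hpq).trans (le_max_left _ _))]
    exact eval_hPoly_nonneg hM hx hx' pq
  · rw [riesz_diracMoments ((totalDegree_rename_mul_self_le _ hq).trans (le_max_right _ _)),
      map_mul, map_mul]
    exact mul_self_nonneg _
  · intro a b β γ ha hb
    rw [riesz_diracMoments ((sq (monomial a β + monomial b γ) ▸ totalDegree_rename_mul_self_le _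
      (totalDegree_binomial_le β γ ha hb)).trans (le_max_right _ _)), map_pow, map_pow]
    exact sq_nonneg _

theorem valDRP_le_valP (hf : f.totalDegree ≤ d) (hg : ∀ i, (g i).totalDegree ≤ d) (hM : 0 < M)
    (hgM : ∀ x ∈ feasibleSet g, ∀ i, eval x (g i) ≤ M) (hk : 1 ≤ k) :
    valDRP n₁ n₂ f g M d r k ≤ valP f g := by
  refine le_iInf₂ fun x hx => ?_
  have hfD : f.totalDegree ≤ max (k * d) r :=
    hf.trans ((Nat.le_mul_of_pos_left d hk).trans (le_max_left _ _))
  rw [← riesz_diracMoments hfD x]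
  exact iInf₂_le _ (diracMoments_mem_feasDRP hg hM hx (hgM x hx))

theorem zero_mem_SOS (n d : ℕ) : (0 : MvPolynomial (Fin n) ℝ) ∈ SOS n d :=
  ⟨IsSumSq.zero, by simp, fun _ => rfl⟩

theorem zero_mem_SDSOS (n d : ℕ) : (0 : MvPolynomial (Fin n) ℝ) ∈ SDSOS n d :=
  ⟨⟨∅, 0, 0, 0, 0, 0, by simp, by simp, by simp⟩, by simp, fun _ => rfl⟩

/-- For a real `μ` strictly between `a` and `val(P)`, the polynomial `f - μ` is positive on `K`, so
it has a certificate at some level without any squares; monotonicity keeps it at later levels. -/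
theorem eventually_lt_valRP (hM : 0 < M)
    (hgen : Algebra.adjoin ℝ (insert 1 (Set.range g)) = ⊤) {a : EReal} (ha : a < valP f g) :
    ∀ᶠ k in atTop, a < valRP n₁ n₂ f g M r k := by
  obtain ⟨μ, haμ, hμ⟩ := EReal.lt_iff_exists_real_btwn.1 ha
  obtain ⟨k, c, hc, h⟩ := exists_level_of_pos hM hgen (p := f - C μ) fun x hx => by
    have h1 : (μ : EReal) < eval x f := hμ.trans_le (iInf₂_le x hx)
    rw [map_sub, eval_C, sub_pos]
    exact EReal.coe_lt_coe_iff.1 h1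
  have hmem : μ ∈ feasRP n₁ n₂ f g M r k :=
    ⟨c, hc, 0, zero_mem_SOS _ _, 0, zero_mem_SDSOS _ _, by rw [← h]; simp⟩
  filter_upwards [eventually_ge_atTop k] with k' hk'
  exact haμ.trans_le ((le_iSup₂ (f := fun (μ : ℝ) (_ : μ ∈ feasRP n₁ n₂ f g M r k) =>
    (μ : EReal)) μ hmem).trans (valRP_mono hk'))

end WeakDuality

/-! ### Closed cones over compact sets and Farkas' lemma -/

section Cone

/-- By Carathéodory the hull is a finite union of continuous images of the compact sets `stdSimplex
× s^j`, with `j ≤ dim E + 1`. -/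
theorem isCompact_convexHull_of_finiteDimensional {E : Type*} [NormedAddCommGroup E]
    [NormedSpace ℝ E] [FiniteDimensional ℝ E] {s : Set E} (hs : IsCompact s) :
    IsCompact (convexHull ℝ s) := by
  have h : convexHull ℝ s = ⋃ j ∈ Finset.range (Module.finrank ℝ E + 2),
      (fun wz : (Fin j → ℝ) × (Fin j → E) => ∑ i, wz.1 i • wz.2 i) ''
        (stdSimplex ℝ (Fin j) ×ˢ Set.univ.pi fun _ => s) := by
    apply Set.Subset.antisymm
    · intro x hx
      obtain ⟨ι, _, z, w, hz, haff, hw, hw1, rfl⟩ := eq_pos_convex_span_of_mem_convexHull hx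
      have hcard : Fintype.card ι < Module.finrank ℝ E + 2 := by
        have := haff.card_le_finrank_succ
        have h2 := Submodule.finrank_le (vectorSpan ℝ (Set.range z))
        omega
      refine Set.mem_biUnion (Finset.mem_range.2 hcard) ?_
      let e := (Fintype.equivFin ι).symm
      refine ⟨(w ∘ e, z ∘ e), ⟨⟨fun i => (hw _).le, ?_⟩, fun i _ => hz ⟨_, rfl⟩⟩, ?_⟩
      · rw [← hw1]; exact e.sum_comp w
      · exact e.sum_comp fun i => w i • z i
    · intro x hx
      obtain ⟨j, -, ⟨w, z⟩, ⟨⟨hw, hw1⟩, hz⟩, rfl⟩ := Set.mem_iUnion₂.1 hx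
      exact (convex_convexHull ℝ s).sum_mem (fun i _ => hw i) hw1
        fun i hi => subset_convexHull ℝ s (hz i (Set.mem_univ i))
  rw [h]
  refine Finset.isCompact_biUnion _ fun j _ => IsCompact.image
    ((isCompact_stdSimplex ℝ (Fin j)).prod (isCompact_univ_pi fun _ => hs)) ?_
  fun_prop

/-- Since `0 ∉ s`, the factor in `X = t • z` is recovered as `t = ‖X‖ / ‖z‖`. It therefore converges
along a subsequence on which `z` does. -/
theorem isClosed_cone_of_isCompact {E : Type*} [NormedAddCommGroup E] [NormedSpace ℝ E]
    {s : Set E} (hs : IsCompact s) (h0 : (0 : E) ∉ s) :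
    IsClosed {x : E | ∃ t : ℝ, 0 ≤ t ∧ ∃ z ∈ s, t • z = x} := by
  refine isClosed_of_closure_subset fun x hx => ?_
  obtain ⟨X, hX, hlim⟩ := mem_closure_iff_seq_limit.1 hx
  choose t ht z hz hXz using hX
  obtain ⟨a, ha, φ, hφ, hφlim⟩ := hs.tendsto_subseq hz
  have hne : ∀ b ∈ s, ‖b‖ ≠ 0 := fun b hb h => h0 (norm_eq_zero.1 h ▸ hb)
  have hXlim : Tendsto (fun j => X (φ j)) atTop (𝓝 x) := hlim.comp hφ.tendsto_atTop
  have ht' : ∀ j, t j = ‖X j‖ / ‖z j‖ := fun j => by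
    rw [← hXz, norm_smul, Real.norm_of_nonneg (ht j), mul_div_cancel_right₀ _ (hne _ (hz j))]
  refine ⟨‖x‖ / ‖a‖, by positivity, a, ha, ?_⟩
  refine tendsto_nhds_unique ?_ hXlim
  have : (fun j => X (φ j)) = fun j => (‖X (φ j)‖ / ‖z (φ j)‖) • z (φ j) := by
    funext j
    rw [← ht', hXz]
  rw [this]
  exact (hXlim.norm.div hφlim.norm (hne a ha)).smul hφlim

open scoped Pointwise in
/-- Farkas' lemma for the cone generated by a compact set whose convex hull does not contain the
origin. -/
theorem exists_dual_of_notMem_cone {ι : Type*} [Fintype ι] {S : Set (ι → ℝ)} (hS : IsCompact S)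
    (hne : S.Nonempty) (h0 : (0 : ι → ℝ) ∉ convexHull ℝ S) {x : ι → ℝ}
    (hx : ∀ t : ℝ, 0 ≤ t → ∀ z ∈ convexHull ℝ S, t • z ≠ x) :
    ∃ y : ι → ℝ, (∀ s ∈ S, 0 ≤ ∑ i, s i * y i) ∧ ∑ i, x i * y i < 0 := by
  classical
  obtain ⟨s₀, hs₀⟩ := hne
  set P : Set (ι → ℝ) := {x | ∃ t : ℝ, 0 ≤ t ∧ ∃ z ∈ convexHull ℝ S, t • z = x}
  have hclosed : IsClosed P :=
    isClosed_cone_of_isCompact (isCompact_convexHull_of_finiteDimensional hS) h0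
  have hconv : Convex ℝ P := by
    rintro _ ⟨t, ht, z, hz, rfl⟩ _ ⟨t', ht', z', hz', rfl⟩ a b ha hb -
    rw [smul_smul, smul_smul]
    have h := (convex_convexHull ℝ S).add_smul (mul_nonneg ha ht) (mul_nonneg hb ht')
    have hmem : (a * t) • z + (b * t') • z' ∈ (a * t + b * t') • convexHull ℝ S := by
      rw [h]
      exact Set.add_mem_add (Set.smul_mem_smul_set hz) (Set.smul_mem_smul_set hz')
    obtain ⟨w, hw, hw'⟩ := hmem
    exact ⟨a * t + b * t', by positivity, w, hw, hw'⟩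
  have hxP : x ∉ P := by
    rintro ⟨t, ht, z, hz, h⟩
    exact hx t ht z hz h
  obtain ⟨F, u, hF, hu⟩ := geometric_hahn_banach_closed_point hconv hclosed hxP
  have hu0 : 0 < u := by
    have := hF 0 ⟨0, le_rfl, s₀, subset_convexHull ℝ S hs₀, zero_smul _ _⟩
    rwa [map_zero] at this
  have hsum : ∀ v : ι → ℝ, ∑ i, v i * -F (Pi.single i 1) = -F v := fun v => by
    have := LinearMap.pi_apply_eq_sum_univ (F : (ι → ℝ) →ₗ[ℝ] ℝ) v
    simp only [ContinuousLinearMap.coe_coe, smul_eq_mul] at this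
    rw [this]
    simp only [mul_neg, Finset.sum_neg_distrib]
    congr! 4 with i
    ext j
    simp [Pi.single_apply, eq_comm]
  refine ⟨fun i => -F (Pi.single i 1), fun s hs => ?_, ?_⟩
  · rw [hsum]
    by_contra! hneg
    have hFs : 0 < F s := by linarith
    -- `F < u` on the whole cone, but this rescaling of `s` would give `F` the value `u`.
    have := hF ((u / F s) • s) ⟨u / F s, by positivity, s, subset_convexHull ℝ S hs, rfl⟩
    rw [map_smul, smul_eq_mul, div_mul_cancel₀ _ hFs.ne'] at this
    exact lt_irrefl _ this
  · rw [hsum]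
    linarith

end Cone

/-! ### The cone of scaled diagonally dominant sums of squares -/

section SDSOS

variable {n : ℕ}

/-- The positive semidefinite quadratic forms in the two monomials `xᵃ`, `xᵇ`. -/
def binaryForms (a b : Fin n →₀ ℕ) : Set (MvPolynomial (Fin n) ℝ) :=
  {p | ∃ A B D : ℝ, 0 ≤ A ∧ 0 ≤ D ∧ B ^ 2 ≤ A * D ∧
    p = C A * monomial a 1 ^ 2 + 2 * C B * monomial a 1 * monomial b 1 + C D * monomial b 1 ^ 2}

theorem zero_mem_binaryForms (a b : Fin n →₀ ℕ) : 0 ∈ binaryForms a b :=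
  ⟨0, 0, 0, le_rfl, le_rfl, by simp, by simp⟩

/-- This is closure of positive semidefinite `2 × 2` matrices under addition; the cross term `2 B
B'` is bounded by AM-GM. The definition of `IsSDSOS` allows one plus and one minus square per pair,
so its closure under addition is seen through these forms. -/
theorem add_mem_binaryForms {a b : Fin n →₀ ℕ} {p q : MvPolynomial (Fin n) ℝ}
    (hp : p ∈ binaryForms a b) (hq : q ∈ binaryForms a b) : p + q ∈ binaryForms a b := by
  obtain ⟨A, B, D, hA, hD, h, rfl⟩ := hp
  obtain ⟨A', B', D', hA', hD', h', rfl⟩ := hq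
  refine ⟨A + A', B + B', D + D', add_nonneg hA hA', add_nonneg hD hD', ?_, ?_⟩
  · have h1 : (B * B') ^ 2 ≤ (A * D') * (A' * D) := by
      calc (B * B') ^ 2 = B ^ 2 * B' ^ 2 := by ring
        _ ≤ (A * D) * (A' * D') := mul_le_mul h h' (sq_nonneg _) (mul_nonneg hA hD)
        _ = _ := by ring
    have h2 : 2 * (B * B') ≤ A * D' + A' * D := by
      have hnn : 0 ≤ A * D' + A' * D :=
        add_nonneg (mul_nonneg hA hD') (mul_nonneg hA' hD)
      refine abs_le_of_sq_le_sq' ?_ hnn |>.2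
      nlinarith [sq_nonneg (A * D' - A' * D)]
    nlinarith
  · simp only [C_add]
    ring

theorem sq_mem_binaryForms (a b : Fin n →₀ ℕ) (β γ : ℝ) :
    (C β * monomial a 1 + C γ * monomial b 1) ^ 2 ∈ binaryForms a b :=
  ⟨β ^ 2, β * γ, γ ^ 2, sq_nonneg _, sq_nonneg _, by rw [mul_pow], by
    simp only [C_mul, C_pow]; ring⟩

theorem smul_mem_binaryForms {a b : Fin n →₀ ℕ} {p : MvPolynomial (Fin n) ℝ} {t : ℝ} (ht : 0 ≤ t)
    (hp : p ∈ binaryForms a b) : C t * p ∈ binaryForms a b := by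
  obtain ⟨A, B, D, hA, hD, h, rfl⟩ := hp
  refine ⟨t * A, t * B, t * D, mul_nonneg ht hA, mul_nonneg ht hD, ?_, ?_⟩
  · nlinarith [mul_le_mul_of_nonneg_left h (sq_nonneg t)]
  · simp only [C_mul]; ring

/-- Completing the square in the second monomial leaves the nonnegative multiple `A - B² / D` of the
first one squared. The sign of `B` decides between the plus and the minus square. -/
theorem exists_of_mem_binaryForms {a b : Fin n →₀ ℕ} {p : MvPolynomial (Fin n) ℝ}
    (hp : p ∈ binaryForms a b) :
    ∃ α βp γp βm γm : ℝ, 0 ≤ α ∧ (0 ≤ βp ∧ 0 ≤ γp ∧ 0 ≤ βm ∧ 0 ≤ γm) ∧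
      p = C α * monomial a 1 ^ 2 + (C βp * monomial a 1 + C γp * monomial b 1) ^ 2
        + (C βm * monomial a 1 - C γm * monomial b 1) ^ 2 := by
  obtain ⟨A, B, D, hA, hD, h, rfl⟩ := hp
  rcases hD.eq_or_lt with rfl | hD
  · have hB : B = 0 := by
      rw [mul_zero] at h
      exact pow_eq_zero_iff two_ne_zero |>.1 (le_antisymm h (sq_nonneg _))
    subst hB
    exact ⟨A, 0, 0, 0, 0, hA, by simp, by simp⟩
  · have hs : 0 < √D := Real.sqrt_pos.2 hD
    have hα : 0 ≤ A - (B / √D) ^ 2 := by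
      rw [div_pow, Real.sq_sqrt hD.le, sub_nonneg, div_le_iff₀ hD]
      exact h
    have key : (C A * monomial a 1 ^ 2 + 2 * C B * monomial a 1 * monomial b 1
        + C D * monomial b 1 ^ 2 : MvPolynomial (Fin n) ℝ)
        = C (A - (B / √D) ^ 2) * monomial a 1 ^ 2
          + (C (B / √D) * monomial a 1 + C √D * monomial b 1) ^ 2 := by
      have e1 : (C D : MvPolynomial (Fin n) ℝ) = C √D ^ 2 := by
        rw [← C_pow, Real.sq_sqrt hD.le]
      have e2 : (C B : MvPolynomial (Fin n) ℝ) = C (B / √D) * C √D := by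
        rw [← C_mul, div_mul_cancel₀ _ hs.ne']
      rw [e1, e2, C_sub, C_pow]
      ring
    rcases le_total 0 B with hB | hB
    · refine ⟨_, B / √D, √D, 0, 0, hα, ⟨by positivity, hs.le, le_rfl, le_rfl⟩, ?_⟩
      rw [key]; simp
    · refine ⟨_, 0, 0, -B / √D, √D, hα, ⟨le_rfl, le_rfl, ?_, hs.le⟩, ?_⟩
      · exact div_nonneg (neg_nonneg.2 hB) hs.le
      · rw [key, neg_div, C_neg]; simp only [C_0]; ring

/-- Scaled diagonally dominant sums of squares as sums of binary positive semidefinite forms. -/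
theorem isSDSOS_iff {s : MvPolynomial (Fin n) ℝ} :
    IsSDSOS s ↔ ∃ (S : Finset (Fin n →₀ ℕ)) (α : (Fin n →₀ ℕ) → ℝ)
      (F : (Fin n →₀ ℕ) × (Fin n →₀ ℕ) → MvPolynomial (Fin n) ℝ),
      (∀ a, 0 ≤ α a) ∧ (∀ e, F e ∈ binaryForms e.1 e.2) ∧
      s = ∑ a ∈ S, C (α a) * monomial a 1 ^ 2 + ∑ e ∈ S.offDiag, F e := by
  constructor
  · rintro ⟨S, α, βp, γp, βm, γm, hα, -, hs⟩
    refine ⟨S, α, fun e => (C (βp e.1 e.2) * monomial e.1 1 + C (γp e.1 e.2) * monomial e.2 1) ^ 2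
      + (C (βm e.1 e.2) * monomial e.1 1 - C (γm e.1 e.2) * monomial e.2 1) ^ 2, hα, fun e => ?_, ?_⟩
    · refine add_mem_binaryForms (sq_mem_binaryForms _ _ _ _) ?_
      have := sq_mem_binaryForms e.1 e.2 (βm e.1 e.2) (-γm e.1 e.2)
      rwa [C_neg, neg_mul, ← sub_eq_add_neg] at this
    · rw [hs, Finset.sum_add_distrib, add_assoc]
  · rintro ⟨S, α, F, hα, hF, hs⟩
    choose x βp γp βm γm hx hβ hFe using fun e => exists_of_mem_binaryForms (hF e)
    -- The pure square left over from each pair is credited to the first monomial of that pair.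
    refine ⟨S, fun a => α a + ∑ e ∈ S.offDiag with e.1 = a, x e, fun a b => βp (a, b),
      fun a b => γp (a, b), fun a b => βm (a, b), fun a b => γm (a, b), fun a => ?_,
      fun a b => hβ (a, b), ?_⟩
    · exact add_nonneg (hα a) (Finset.sum_nonneg fun e _ => hx e)
    · have h1 : ∑ a ∈ S, C (∑ e ∈ S.offDiag with e.1 = a, x e) * monomial a (1 : ℝ) ^ 2
          = ∑ e ∈ S.offDiag, C (x e) * monomial e.1 1 ^ 2 := by
        rw [← Finset.sum_fiberwise_of_maps_to (g := fun e : (Fin n →₀ ℕ) × (Fin n →₀ ℕ) => e.1)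
          (fun e he => (Finset.mem_offDiag.1 he).1)]
        refine Finset.sum_congr rfl fun a _ => ?_
        rw [map_sum, Finset.sum_mul]
        refine Finset.sum_congr rfl fun e he => ?_
        rw [(Finset.mem_filter.1 he).2]
      rw [hs]
      simp only [C_add, add_mul, Finset.sum_add_distrib, h1]
      rw [Finset.sum_congr rfl fun e _ => hFe e]
      simp only [Finset.sum_add_distrib]
      ring

theorem sum_ite_mem_of_subset {ι A : Type*} [DecidableEq ι] [AddCommMonoid A] {S S' : Finset ι}
    (h : S ⊆ S') (F : ι → A) : ∑ i ∈ S', (if i ∈ S then F i else 0) = ∑ i ∈ S, F i := by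
  rw [Finset.sum_ite_mem, Finset.inter_eq_right.2 h]

theorem IsSDSOS.add {s t : MvPolynomial (Fin n) ℝ} (hs : IsSDSOS s) (ht : IsSDSOS t) :
    IsSDSOS (s + t) := by
  obtain ⟨S, α, F, hα, hF, rfl⟩ := isSDSOS_iff.1 hs
  obtain ⟨S', α', F', hα', hF', rfl⟩ := isSDSOS_iff.1 ht
  have h1 : S ⊆ S ∪ S' := Finset.subset_union_left
  have h2 : S' ⊆ S ∪ S' := Finset.subset_union_right
  refine isSDSOS_iff.2 ⟨S ∪ S', fun a => (if a ∈ S then α a else 0) + if a ∈ S' then α' a else 0,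
    fun e => (if e ∈ S.offDiag then F e else 0) + if e ∈ S'.offDiag then F' e else 0,
    fun a => ?_, fun e => ?_, ?_⟩
  · have := hα a
    have := hα' a
    positivity
  · refine add_mem_binaryForms ?_ ?_
    · split_ifs
      exacts [hF e, zero_mem_binaryForms _ _]
    · split_ifs
      exacts [hF' e, zero_mem_binaryForms _ _]
  · simp only [C_add, add_mul, Finset.sum_add_distrib]
    rw [sum_ite_mem_of_subset (Finset.offDiag_mono h1),
      sum_ite_mem_of_subset (Finset.offDiag_mono h2)]
    simp only [apply_ite C, C_0, ite_mul, zero_mul]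
    rw [sum_ite_mem_of_subset h1, sum_ite_mem_of_subset h2]
    ring

theorem IsSDSOS.C_mul {s : MvPolynomial (Fin n) ℝ} (hs : IsSDSOS s) {t : ℝ} (ht : 0 ≤ t) :
    IsSDSOS (C t * s) := by
  obtain ⟨S, α, F, hα, hF, rfl⟩ := isSDSOS_iff.1 hs
  refine isSDSOS_iff.2 ⟨S, fun a => t * α a, fun e => C t * F e, fun a => mul_nonneg ht (hα a),
    fun e => smul_mem_binaryForms ht (hF e), ?_⟩
  simp only [mul_add, Finset.mul_sum, MvPolynomial.C_mul, mul_assoc]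

theorem isSDSOS_binomial_sq (a b : Fin n →₀ ℕ) (β γ : ℝ) :
    IsSDSOS ((monomial a β + monomial b γ) ^ 2) := by
  have hm : ∀ (a : Fin n →₀ ℕ) (c : ℝ), monomial a c = C c * monomial a 1 := fun a c => by
    rw [C_mul_monomial, mul_one]
  rw [hm a, hm b]
  refine isSDSOS_iff.2 ?_
  by_cases hab : a = b
  · subst hab
    refine ⟨{a}, fun _ => (β + γ) ^ 2, 0, fun _ => sq_nonneg _,
      fun _ => zero_mem_binaryForms _ _, ?_⟩
    simp only [Finset.sum_singleton, Pi.zero_apply, Finset.sum_const_zero, C_pow, C_add]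
    ring
  · refine ⟨{a, b}, 0, fun e => if e = (a, b) then
      (C β * monomial a 1 + C γ * monomial b 1) ^ 2 else 0, fun _ => le_rfl, fun e => ?_, ?_⟩
    · dsimp only
      split_ifs with h
      · subst h; exact sq_mem_binaryForms _ _ _ _
      · exact zero_mem_binaryForms _ _
    · rw [Finset.sum_ite_eq' _ (a, b), if_pos (by simp [hab])]
      simp

end SDSOS

/-! ### Coefficient vectors -/

section CoefficientVectors

variable {n D : ℕ}

/-- The vector of coefficients of degree at most `D`. -/
noncomputable def coeffVec (D : ℕ) : MvPolynomial (Fin n) ℝ →ₗ[ℝ] (MIdx n D → ℝ) :=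
  LinearMap.pi fun a => lcoeff ℝ a.1

theorem sum_coeffVec_mul (p : MvPolynomial (Fin n) ℝ) (y : MIdx n D → ℝ) :
    ∑ a, coeffVec D p a * y a = riesz y p := rfl

/-- The polynomial with given coefficients. -/
noncomputable def ofCoeffVec (D : ℕ) : (MIdx n D → ℝ) →ₗ[ℝ] MvPolynomial (Fin n) ℝ :=
  ∑ a : MIdx n D, (monomial a.1).comp (LinearMap.proj a)

theorem ofCoeffVec_apply (v : MIdx n D → ℝ) : ofCoeffVec D v = ∑ a, monomial a.1 (v a) := by
  simp [ofCoeffVec]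

theorem ofCoeffVec_coeffVec {p : MvPolynomial (Fin n) ℝ} (hp : p.totalDegree ≤ D) :
    ofCoeffVec D (coeffVec D p) = p := by
  rw [ofCoeffVec_apply]
  conv_rhs => rw [p.as_sum]
  symm
  refine Finset.sum_bij_ne_zero (fun a ha _ => ⟨a, (le_totalDegree ha).trans hp⟩) ?_ ?_ ?_ ?_
  · simp
  · intro a _ _ b _ _ hab
    exact congrArg (fun z : MIdx n D => z.1) hab
  · intro b _ hb
    refine ⟨b.1, ?_, hb, rfl⟩
    rw [mem_support_iff]
    intro h
    exact hb (by
      have : coeffVec D p b = 0 := h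
      rw [this, map_zero])
  · intro a _ _
    rfl

theorem totalDegree_ofCoeffVec_le (v : MIdx n D → ℝ) : (ofCoeffVec D v).totalDegree ≤ D := by
  rw [ofCoeffVec_apply]
  exact totalDegree_finsetSum_le fun a _ => (totalDegree_monomial_le _ _).trans a.2

theorem coeffVec_ofCoeffVec (v : MIdx n D → ℝ) : coeffVec D (ofCoeffVec D v) = v := by
  funext a
  rw [ofCoeffVec_apply]
  change coeff a.1 _ = _
  rw [coeff_sum, Finset.sum_eq_single a]
  · simp
  · intro b _ hb
    rw [coeff_monomial, if_neg fun h => hb (Subtype.ext h)]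
  · simp

theorem ofCoeffVec_ne_zero {v : MIdx n D → ℝ} (hv : v ≠ 0) : ofCoeffVec D v ≠ 0 := fun h =>
  hv (by rw [← coeffVec_ofCoeffVec v, h, map_zero])

theorem continuous_coeffVec_rename_sq {k u : ℕ} (e : Fin k → Fin n) :
    Continuous fun v : MIdx k u → ℝ =>
      coeffVec D (rename e (ofCoeffVec u v * ofCoeffVec u v)) := by
  have h : ∀ v : MIdx k u → ℝ, coeffVec D (rename e (ofCoeffVec u v * ofCoeffVec u v))
      = ∑ a, ∑ b, (v a * v b) •
        coeffVec D (rename e (monomial a.1 (1 : ℝ) * monomial b.1 1)) := by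
    intro v
    have hm : ∀ (a : Fin k →₀ ℕ) (c : ℝ), monomial a c = c • monomial a 1 := fun a c => by
      rw [smul_monomial, smul_eq_mul, mul_one]
    rw [ofCoeffVec_apply, Finset.sum_mul_sum]
    simp only [map_sum]
    refine Finset.sum_congr rfl fun a _ => Finset.sum_congr rfl fun b _ => ?_
    rw [hm a.1 (v a), hm b.1 (v b), smul_mul_smul_comm, map_smul, map_smul]
  simp only [h]
  fun_prop

/-- A ball in the sup norm is a product of infinite sets, on which only the zero polynomial
vanishes. -/
theorem eq_zero_of_eval_eq_zero_of_mem_interior {p : MvPolynomial (Fin n) ℝ}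
    {K : Set (Fin n → ℝ)} (hK : (interior K).Nonempty) (hp : ∀ x ∈ K, eval x p = 0) : p = 0 := by
  obtain ⟨x, hx⟩ := hK
  obtain ⟨ε, hε, hball⟩ := Metric.isOpen_iff.1 isOpen_interior x hx
  refine funext_set (fun i => Metric.ball (x i) ε) (fun i => ?_) fun z hz => ?_
  · rw [Real.ball_eq_Ioo]
    exact Set.Ioo_infinite (by linarith)
  · rw [map_zero]
    rw [← ball_pi x hε] at hz
    exact hp z (interior_subset (hball hz))

end CoefficientVectors

/-! ### The primal cone -/

section PrimalCone

variable (n₁ n₂ : ℕ) {m : ℕ} (g : Fin m → MvPolynomial (Fin (n₁ + n₂)) ℝ) (M : ℝ) (r k : ℕ)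

/-- The cone of polynomials `∑ c_{p,q} h_{p,q} + σ₁ + σ₂`. -/
def primalCone : Set (MvPolynomial (Fin (n₁ + n₂)) ℝ) :=
  {p | ∃ c : (Fin m → ℕ) × (Fin m → ℕ) → ℝ, (∀ pq, 0 ≤ c pq) ∧
    ∃ σ₁ ∈ SOS n₁ r, ∃ σ₂ ∈ SDSOS n₂ r,
      p = ∑ pq ∈ levelIdx m k, C (c pq) * hPoly M g pq
        + (rename (Fin.castAdd n₂) σ₁ + rename (Fin.natAdd n₁) σ₂)}

variable {n₁ n₂ g M r k}

theorem mem_feasRP_iff {f : MvPolynomial (Fin (n₁ + n₂)) ℝ} {μ : ℝ} :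
    μ ∈ feasRP n₁ n₂ f g M r k ↔ f - C μ ∈ primalCone n₁ n₂ g M r k := by
  have h : ∀ a b c d : MvPolynomial (Fin (n₁ + n₂)) ℝ, a - b - c = d ↔ a - c = b + d :=
    fun a b c d => by
      rw [sub_right_comm, sub_eq_iff_eq_add, add_comm d b]
  simp only [feasRP, primalCone, Set.mem_ofPred_eq, h]

theorem add_mem_primalCone {p q : MvPolynomial (Fin (n₁ + n₂)) ℝ}
    (hp : p ∈ primalCone n₁ n₂ g M r k) (hq : q ∈ primalCone n₁ n₂ g M r k) :
    p + q ∈ primalCone n₁ n₂ g M r k := by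
  obtain ⟨c, hc, σ₁, ⟨h1, h1', h1''⟩, σ₂, ⟨h2, h2', h2''⟩, rfl⟩ := hp
  obtain ⟨c', hc', τ₁, ⟨t1, t1', t1''⟩, τ₂, ⟨t2, t2', t2''⟩, rfl⟩ := hq
  refine ⟨fun pq => c pq + c' pq, fun pq => add_nonneg (hc pq) (hc' pq),
    σ₁ + τ₁, ⟨h1.add t1, (totalDegree_add _ _).trans (max_le h1' t1'), fun h => ?_⟩,
    σ₂ + τ₂, ⟨h2.add t2, (totalDegree_add _ _).trans (max_le h2' t2'), fun h => ?_⟩, ?_⟩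
  · rw [h1'' h, t1'' h, add_zero]
  · rw [h2'' h, t2'' h, add_zero]
  · simp only [map_add, add_mul, Finset.sum_add_distrib]
    ring

theorem C_mul_mem_primalCone {p : MvPolynomial (Fin (n₁ + n₂)) ℝ} {t : ℝ} (ht : 0 ≤ t)
    (hp : p ∈ primalCone n₁ n₂ g M r k) : C t * p ∈ primalCone n₁ n₂ g M r k := by
  obtain ⟨c, hc, σ₁, ⟨h1, h1', h1''⟩, σ₂, ⟨h2, h2', h2''⟩, rfl⟩ := hp
  refine ⟨fun pq => t * c pq, fun pq => mul_nonneg ht (hc pq),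
    C t * σ₁, ⟨?_, ?_, fun h => ?_⟩, C t * σ₂, ⟨h2.C_mul ht, ?_, fun h => ?_⟩, ?_⟩
  · have : IsSumSq (C t : MvPolynomial (Fin n₁) ℝ) := by
      rw [← Real.mul_self_sqrt ht, C_mul]
      exact IsSumSq.mul_self _
    exact this.mul h1
  · rw [← smul_eq_C_mul]
    exact (totalDegree_smul_le _ _).trans h1'
  · rw [h1'' h, mul_zero]
  · rw [← smul_eq_C_mul]
    exact (totalDegree_smul_le _ _).trans h2'
  · rw [h2'' h, mul_zero]
  · simp only [map_mul, rename_C, Finset.mul_sum, mul_add, mul_assoc]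

theorem hPoly_mem_primalCone {pq : (Fin m → ℕ) × (Fin m → ℕ)} (hpq : pq ∈ levelIdx m k) :
    hPoly M g pq ∈ primalCone n₁ n₂ g M r k := by
  refine ⟨Pi.single pq 1, fun a => ?_, 0, zero_mem_SOS _ _, 0, zero_mem_SDSOS _ _, ?_⟩
  · by_cases h : a = pq
    · subst h; simp
    · simp [h]
  · rw [Finset.sum_eq_single pq]
    · simp
    · intro b _ hb; simp [hb]
    · intro h; exact absurd hpq h

theorem zero_mem_levelIdx : (0 : (Fin m → ℕ) × (Fin m → ℕ)) ∈ levelIdx m k := by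
  simp [mem_levelIdx]

theorem C_mem_primalCone {t : ℝ} (ht : 0 ≤ t) : C t ∈ primalCone n₁ n₂ g M r k := by
  have := C_mul_mem_primalCone ht
    (hPoly_mem_primalCone (n₁ := n₁) (n₂ := n₂) (g := g) (M := M) (r := r)
      (zero_mem_levelIdx (m := m) (k := k)))
  rwa [hPoly_zero, mul_one] at this

/-- Without variables in a block, `SOS` and `SDSOS` are `{0}` by convention, while the moment matrix
still has the row of the zero exponent. The constant squares tested there belong to the primal cone
through `h_{0,0} = 1`. -/
theorem rename_sq_eq_C {j l : ℕ} (hj : j = 0) (e : Fin j → Fin l) (q : MvPolynomial (Fin j) ℝ) :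
    ∃ t : ℝ, 0 ≤ t ∧ rename e (q * q) = C t := by
  subst hj
  obtain ⟨a, rfl⟩ := C_surjective (Fin 0) q
  exact ⟨a * a, mul_self_nonneg a, by rw [← C_mul, rename_C]⟩

theorem rename_castAdd_sq_mem_primalCone {q : MvPolynomial (Fin n₁) ℝ}
    (hq : q.totalDegree ≤ r / 2) :
    rename (Fin.castAdd n₂) (q * q) ∈ primalCone n₁ n₂ g M r k := by
  by_cases hn : n₁ = 0
  · obtain ⟨t, ht, h⟩ := rename_sq_eq_C hn (Fin.castAdd n₂) q
    rw [h]
    exact C_mem_primalCone ht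
  · exact ⟨0, fun _ => le_rfl, q * q, ⟨IsSumSq.mul_self q,
      (totalDegree_mul _ _).trans (by omega), fun h => absurd h hn⟩, 0, zero_mem_SDSOS _ _, by simp⟩

theorem rename_natAdd_sq_mem_primalCone {a b : Fin n₂ →₀ ℕ} (β γ : ℝ) (ha : a.degree ≤ r / 2)
    (hb : b.degree ≤ r / 2) :
    rename (Fin.natAdd n₁) ((monomial a β + monomial b γ) * (monomial a β + monomial b γ))
      ∈ primalCone n₁ n₂ g M r k := by
  by_cases hn : n₂ = 0
  · obtain ⟨t, ht, h⟩ := rename_sq_eq_C hn (Fin.natAdd n₁) (monomial a β + monomial b γ)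
    rw [h]
    exact C_mem_primalCone ht
  · refine ⟨0, fun _ => le_rfl, 0, zero_mem_SOS _ _,
      (monomial a β + monomial b γ) * (monomial a β + monomial b γ), ⟨?_,
      (totalDegree_mul _ _).trans ?_, fun h => absurd h hn⟩, by simp⟩
    · rw [← sq]; exact isSDSOS_binomial_sq a b β γ
    · have := totalDegree_binomial_le β γ ha hb
      omega

end PrimalCone

/-! ### Strong duality by separation from the primal cone -/

section StrongDuality

variable {n₁ n₂ m d r k : ℕ} {f : MvPolynomial (Fin (n₁ + n₂)) ℝ}
  {g : Fin m → MvPolynomial (Fin (n₁ + n₂)) ℝ} {M : ℝ}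

/-- The vectors in the unit sphere with support in `{a, b}`. -/
def binomialSphere {j u : ℕ} (a b : MIdx j u) : Set (MIdx j u → ℝ) :=
  Metric.sphere 0 1 ∩ {v | ∀ c, c ≠ a → c ≠ b → v c = 0}

theorem isCompact_binomialSphere {j u : ℕ} (a b : MIdx j u) :
    IsCompact (binomialSphere a b) := by
  refine (isCompact_sphere _ _).inter_right ?_
  simp only [Set.ofPred_forall]
  exact isClosed_iInter fun c => isClosed_iInter fun _ => isClosed_iInter fun _ =>
    isClosed_eq (by fun_prop) (by fun_prop)

theorem exists_ofCoeffVec_eq_binomial {j u : ℕ} {a b : MIdx j u} {v : MIdx j u → ℝ}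
    (hv : ∀ c, c ≠ a → c ≠ b → v c = 0) :
    ∃ β γ : ℝ, ofCoeffVec u v = monomial a.1 β + monomial b.1 γ := by
  classical
  rw [ofCoeffVec_apply]
  by_cases hab : a = b
  · subst hab
    refine ⟨v a, 0, ?_⟩
    rw [map_zero, add_zero, Finset.sum_eq_single a]
    · intro c _ hc; rw [hv c hc hc, map_zero]
    · simp
  · refine ⟨v a, v b, ?_⟩
    rw [← Finset.sum_pair (f := fun c : MIdx j u => monomial c.1 (v c)) hab]
    refine (Finset.sum_subset (Finset.subset_univ _) fun c _ hc => ?_).symm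
    simp only [Finset.mem_insert, Finset.mem_singleton, not_or] at hc
    rw [hv c hc.1 hc.2, map_zero]

variable (n₁ n₂ g M d r k) in
/-- A compact set of generators of the primal cone, in terms of coefficient vectors. -/
def generators : Set (MIdx (n₁ + n₂) (max (k * d) r) → ℝ) :=
  ((fun pq => coeffVec _ (hPoly M g pq)) '' (levelIdx m k : Set _)) ∪
  ((fun v : MIdx n₁ (r / 2) → ℝ => coeffVec _ (rename (Fin.castAdd n₂)
    (ofCoeffVec (r / 2) v * ofCoeffVec (r / 2) v))) '' Metric.sphere 0 1) ∪
  ⋃ a : MIdx n₂ (r / 2), ⋃ b : MIdx n₂ (r / 2),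
    (fun v : MIdx n₂ (r / 2) → ℝ => coeffVec _ (rename (Fin.natAdd n₁)
      (ofCoeffVec (r / 2) v * ofCoeffVec (r / 2) v))) '' binomialSphere a b

theorem isCompact_generators : IsCompact (generators n₁ n₂ d r k g M) := by
  refine IsCompact.union (IsCompact.union ?_ ?_) ?_
  · exact ((levelIdx m k).finite_toSet.image _).isCompact
  · exact (isCompact_sphere _ _).image (continuous_coeffVec_rename_sq _)
  · exact isCompact_iUnion fun a => isCompact_iUnion fun b =>
      (isCompact_binomialSphere a b).image (continuous_coeffVec_rename_sq _)

theorem coeffVec_hPoly_mem_generators {pq : (Fin m → ℕ) × (Fin m → ℕ)}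
    (hpq : pq ∈ levelIdx m k) :
    coeffVec _ (hPoly M g pq) ∈ generators n₁ n₂ d r k g M :=
  Or.inl (Or.inl ⟨pq, hpq, rfl⟩)

theorem exists_polynomial_of_mem_generators (hg : ∀ i, (g i).totalDegree ≤ d)
    {s : MIdx (n₁ + n₂) (max (k * d) r) → ℝ} (hs : s ∈ generators n₁ n₂ d r k g M) :
    ((∃ pq ∈ levelIdx m k, ofCoeffVec _ s = hPoly M g pq) ∨
      ∃ q ≠ 0, ofCoeffVec _ s = q * q) ∧ ofCoeffVec _ s ∈ primalCone n₁ n₂ g M r k := by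
  have hsphere : ∀ {j : ℕ} {v : MIdx j (r / 2) → ℝ}, v ∈ Metric.sphere 0 1 → v ≠ 0 := by
    rintro j _ hv rfl
    simp at hv
  have hsq : ∀ {j : ℕ} (e : Fin j → Fin (n₁ + n₂)) (v : MIdx j (r / 2) → ℝ),
      ofCoeffVec (max (k * d) r) (coeffVec _ (rename e
        (ofCoeffVec (r / 2) v * ofCoeffVec (r / 2) v)))
        = rename e (ofCoeffVec (r / 2) v * ofCoeffVec (r / 2) v) := fun e v =>
    ofCoeffVec_coeffVec ((totalDegree_rename_mul_self_le e
      (totalDegree_ofCoeffVec_le v)).trans (le_max_right _ _))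
  rcases hs with (⟨pq, hpq, rfl⟩ | ⟨v, hv, rfl⟩) | hs
  · have h := ofCoeffVec_coeffVec ((totalDegree_hPoly_le (M := M) hg hpq).trans
      (le_max_left (k * d) r))
    exact ⟨Or.inl ⟨pq, hpq, h⟩, by rw [h]; exact hPoly_mem_primalCone hpq⟩
  · dsimp only
    rw [hsq]
    refine ⟨Or.inr ⟨rename (Fin.castAdd n₂) (ofCoeffVec _ v), ?_, map_mul _ _ _⟩,
      rename_castAdd_sq_mem_primalCone (totalDegree_ofCoeffVec_le v)⟩
    rw [Ne, map_eq_zero_iff _ (rename_injective _ (Fin.castAdd_injective _ _))]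
    exact ofCoeffVec_ne_zero (hsphere hv)
  · obtain ⟨a, ha⟩ := Set.mem_iUnion.1 hs
    obtain ⟨b, v, ⟨hv, hv'⟩, rfl⟩ := Set.mem_iUnion.1 ha
    dsimp only
    rw [hsq]
    refine ⟨Or.inr ⟨rename (Fin.natAdd n₁) (ofCoeffVec _ v), ?_, map_mul _ _ _⟩, ?_⟩
    · rw [Ne, map_eq_zero_iff _ (rename_injective _ (Fin.natAdd_injective _ _))]
      exact ofCoeffVec_ne_zero (hsphere hv)
    · obtain ⟨β, γ, h⟩ := exists_ofCoeffVec_eq_binomial hv'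
      rw [h]
      exact rename_natAdd_sq_mem_primalCone β γ a.2 b.2

theorem hPoly_ne_zero (hM : 0 < M) {x : Fin (n₁ + n₂) → ℝ} (hx : ∀ i, 0 < eval x (g i))
    (hx' : ∀ i, eval x (g i) < M) (pq : (Fin m → ℕ) × (Fin m → ℕ)) : hPoly M g pq ≠ 0 := by
  intro h
  have h0 : eval x (hPoly M g pq) = 0 := by rw [h, map_zero]
  rw [hPoly, map_prod] at h0
  refine absurd h0 (Finset.prod_pos fun i _ => ?_).ne'
  simp only [hat, map_mul, map_pow, map_sub, map_one, eval_C]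
  refine mul_pos (pow_pos (mul_pos (inv_pos.2 hM) (hx i)) _) (pow_pos ?_ _)
  rw [sub_pos, inv_mul_lt_iff₀ hM, mul_one]
  exact hx' i

/-- All generators lie in the set of nonzero polynomials that are nonnegative on `K`; the Slater
point shows this for the `h_{p,q}`. The set is convex: if a combination is zero, a term with
positive weight vanishes on `K`, hence identically because `K` has interior. -/
theorem zero_notMem_convexHull_generators (hg : ∀ i, (g i).totalDegree ≤ d) (hM : 0 < M)
    (hgM : ∀ x ∈ feasibleSet g, ∀ i, eval x (g i) < M)
    (hint : (interior (feasibleSet g)).Nonempty)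
    (hslater : ∃ x₀ ∈ feasibleSet g, ∀ i, 0 < eval x₀ (g i)) :
    0 ∉ convexHull ℝ (generators n₁ n₂ d r k g M) := by
  obtain ⟨x₀, hx₀, hpos⟩ := hslater
  let N : Set (MIdx (n₁ + n₂) (max (k * d) r) → ℝ) :=
    {z | (∀ x ∈ feasibleSet g, 0 ≤ eval x (ofCoeffVec _ z)) ∧ ofCoeffVec _ z ≠ 0}
  have hconv : Convex ℝ N := by
    rintro z ⟨hz, hz0⟩ w ⟨hw, hw0⟩ a b ha hb hab
    have hev : ∀ x, eval x (ofCoeffVec (max (k * d) r) (a • z + b • w))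
        = a * eval x (ofCoeffVec _ z) + b * eval x (ofCoeffVec _ w) := fun x => by
      rw [map_add, map_smul, map_smul, map_add, smul_eval, smul_eval]
    refine ⟨fun x hx => ?_, fun h0 => ?_⟩
    · rw [hev]
      exact add_nonneg (mul_nonneg ha (hz x hx)) (mul_nonneg hb (hw x hx))
    · have hsum : ∀ x ∈ feasibleSet g, a * eval x (ofCoeffVec _ z) = 0 ∧
          b * eval x (ofCoeffVec _ w) = 0 := fun x hx => by
        rw [← add_eq_zero_iff_of_nonneg (mul_nonneg ha (hz x hx)) (mul_nonneg hb (hw x hx)),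
          ← hev, h0, map_zero]
      rcases ha.eq_or_lt with rfl | ha
      · have hb1 : b = 1 := by linarith
        exact hw0 (eq_zero_of_eval_eq_zero_of_mem_interior hint fun x hx => by
          simpa [hb1] using (hsum x hx).2)
      · exact hz0 (eq_zero_of_eval_eq_zero_of_mem_interior hint fun x hx =>
          (mul_eq_zero.1 (hsum x hx).1).resolve_left ha.ne')
  have hsub : generators n₁ n₂ d r k g M ⊆ N := by
    intro s hs
    rcases (exists_polynomial_of_mem_generators hg hs).1 with ⟨pq, hpq, h⟩ | ⟨q, hq, h⟩
    · refine ⟨fun x hx => ?_, ?_⟩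
      · rw [h]; exact eval_hPoly_nonneg hM hx (fun i => (hgM x hx i).le) pq
      · rw [h]; exact hPoly_ne_zero hM hpos (hgM x₀ hx₀) pq
    · refine ⟨fun x _ => ?_, ?_⟩
      · rw [h, map_mul]; exact mul_self_nonneg _
      · rw [h]; exact mul_self_ne_zero.2 hq
  exact fun h0 => (convexHull_min hsub hconv h0).2 (map_zero _)

theorem ofCoeffVec_mem_primalCone (hg : ∀ i, (g i).totalDegree ≤ d)
    {z : MIdx (n₁ + n₂) (max (k * d) r) → ℝ}
    (hz : z ∈ convexHull ℝ (generators n₁ n₂ d r k g M)) :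
    ofCoeffVec _ z ∈ primalCone n₁ n₂ g M r k := by
  refine convexHull_min (t := {z | ofCoeffVec _ z ∈ primalCone n₁ n₂ g M r k})
    (fun s hs => (exists_polynomial_of_mem_generators hg hs).2) ?_ hz
  intro z hz w hw a b ha hb _
  change ofCoeffVec _ (a • z + b • w) ∈ primalCone n₁ n₂ g M r k
  rw [map_add, map_smul, map_smul, smul_eq_C_mul, smul_eq_C_mul]
  exact add_mem_primalCone (C_mul_mem_primalCone ha hz) (C_mul_mem_primalCone hb hw)

/-- Nonnegativity on the normalized squares extends to all squares. -/
theorem riesz_rename_sq_nonneg {j l D u : ℕ} {e : Fin j → Fin l} {y : MIdx l D → ℝ}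
    {v : MIdx j u → ℝ}
    (h : v ≠ 0 → 0 ≤ riesz y (rename e (ofCoeffVec u (‖v‖⁻¹ • v) * ofCoeffVec u (‖v‖⁻¹ • v)))) :
    0 ≤ riesz y (rename e (ofCoeffVec u v * ofCoeffVec u v)) := by
  by_cases hv : v = 0
  · rw [hv, map_zero, mul_zero, map_zero, ← rieszHom_apply, map_zero]
  · have h1 := h hv
    rw [map_smul, smul_mul_smul_comm, map_smul, riesz_smul] at h1
    have : 0 < ‖v‖⁻¹ * ‖v‖⁻¹ := by
      have := norm_pos_iff.2 hv
      positivity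
    exact nonneg_of_mul_nonneg_right h1 this

theorem inv_norm_smul_mem_sphere {E : Type*} [NormedAddCommGroup E] [NormedSpace ℝ E] {v : E}
    (hv : v ≠ 0) : ‖v‖⁻¹ • v ∈ Metric.sphere (0 : E) 1 := by
  rw [mem_sphere_zero_iff_norm, norm_smul, norm_inv, norm_norm,
    inv_mul_cancel₀ (norm_ne_zero_iff.2 hv)]

theorem riesz_nonneg_of_generators {y : MIdx (n₁ + n₂) (max (k * d) r) → ℝ}
    (hy : ∀ s ∈ generators n₁ n₂ d r k g M, 0 ≤ ∑ a, s a * y a) :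
    (∀ pq ∈ levelIdx m k, 0 ≤ riesz y (hPoly M g pq)) ∧
      (∀ q : MvPolynomial (Fin n₁) ℝ, q.totalDegree ≤ r / 2 →
        0 ≤ riesz y (rename (Fin.castAdd n₂) (q * q))) ∧
      ∀ (a b : Fin n₂ →₀ ℕ) (β γ : ℝ), a.degree ≤ r / 2 → b.degree ≤ r / 2 →
        0 ≤ riesz y (rename (Fin.natAdd n₁) ((monomial a β + monomial b γ) ^ 2)) := by
  refine ⟨fun pq hpq => hy _ (coeffVec_hPoly_mem_generators hpq), fun q hq => ?_, ?_⟩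
  · rw [← ofCoeffVec_coeffVec hq]
    exact riesz_rename_sq_nonneg fun hv =>
      hy _ (Or.inl (Or.inr ⟨_, inv_norm_smul_mem_sphere hv, rfl⟩))
  · intro a b β γ ha hb
    rw [sq, ← ofCoeffVec_coeffVec (totalDegree_binomial_le β γ ha hb)]
    refine riesz_rename_sq_nonneg fun hv => hy _ (Or.inr (Set.mem_iUnion.2 ⟨⟨a, ha⟩,
      Set.mem_iUnion.2 ⟨⟨b, hb⟩, _, ⟨inv_norm_smul_mem_sphere hv, fun c hca hcb => ?_⟩, rfl⟩⟩))
    have h1 : coeffVec (r / 2) (monomial a β + monomial b γ) c = 0 := by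
      change coeff c.1 (monomial a β + monomial b γ) = 0
      rw [coeff_add, coeff_monomial, coeff_monomial, if_neg fun h => hca (Subtype.ext h.symm),
        if_neg fun h => hcb (Subtype.ext h.symm), add_zero]
    rw [Pi.smul_apply, h1, smul_zero]

theorem riesz_linear {n D : ℕ} (a b : ℝ) (y z : MIdx n D → ℝ) (p : MvPolynomial (Fin n) ℝ) :
    riesz (a • y + b • z) p = a * riesz y p + b * riesz z p := by
  simp only [riesz, Finset.mul_sum, ← Finset.sum_add_distrib, Pi.add_apply, Pi.smul_apply,
    smul_eq_mul]
  exact Finset.sum_congr rfl fun _ _ => by ring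

/-- If `K` has nonempty interior and a Slater point, then every lower bound of the dual relaxation
is feasible for the primal relaxation. -/
theorem mem_feasRP_of_le_valDRP (hf : f.totalDegree ≤ d) (hg : ∀ i, (g i).totalDegree ≤ d)
    (hM : 0 < M) (hgM : ∀ x ∈ feasibleSet g, ∀ i, eval x (g i) < M)
    (hint : (interior (feasibleSet g)).Nonempty)
    (hslater : ∃ x₀ ∈ feasibleSet g, ∀ i, 0 < eval x₀ (g i)) (hk : 1 ≤ k) {μ : ℝ}
    (hμ : (μ : EReal) ≤ valDRP n₁ n₂ f g M d r k) : μ ∈ feasRP n₁ n₂ f g M r k := by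
  by_contra hcon
  rw [mem_feasRP_iff] at hcon
  have hfD : (f - C μ).totalDegree ≤ max (k * d) r := by
    refine (totalDegree_sub _ _).trans (max_le ?_ (by simp))
    exact hf.trans ((Nat.le_mul_of_pos_left d hk).trans (le_max_left _ _))
  have hfeas : ∀ y ∈ feasDRP n₁ n₂ g M d r k, μ ≤ riesz y f := fun y hy =>
    EReal.coe_le_coe_iff.1 (hμ.trans (iInf₂_le y hy))
  -- Farkas' lemma gives `y` with `L_y ≥ 0` on the primal cone and `L_y(f - μ) < 0`; only the
  -- normalization `y₀ = 1` is missing.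
  obtain ⟨y, hy, hyf⟩ := exists_dual_of_notMem_cone (x := coeffVec _ (f - C μ))
    (isCompact_generators (n₁ := n₁) (n₂ := n₂) (d := d) (g := g) (M := M) (r := r) (k := k))
    ⟨_, coeffVec_hPoly_mem_generators zero_mem_levelIdx⟩
    (zero_notMem_convexHull_generators hg hM hgM hint hslater) (by
      intro t ht z hz heq
      apply hcon
      rw [← ofCoeffVec_coeffVec hfD, ← heq, map_smul, smul_eq_C_mul]
      exact C_mul_mem_primalCone ht (ofCoeffVec_mem_primalCone hg hz))
  rw [sum_coeffVec_mul] at hyf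
  obtain ⟨hh, hsos, hsd⟩ := riesz_nonneg_of_generators hy
  obtain ⟨x₀, hx₀, -⟩ := hslater
  have hδ := diracMoments_mem_feasDRP (n₁ := n₁) (n₂ := n₂) (r := r) (k := k) hg hM hx₀
    fun i => (hgM x₀ hx₀ i).le
  obtain ⟨hδh, hδ1, hδsos, hδsd⟩ := mem_feasDRP_iff.1 hδ
  set δ := diracMoments (max (k * d) r) x₀
  -- The other dual constraints are conic, so every nonnegative combination of `δ` and `y` with
  -- zeroth moment `1` is dual feasible.
  have hcomb : ∀ a b : ℝ, 0 ≤ a → 0 ≤ b → a + b * y ⟨0, by simp⟩ = 1 →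
      μ ≤ a * riesz δ f + b * riesz y f := by
    intro a b ha hb hab
    rw [← riesz_linear]
    refine hfeas _ (mem_feasDRP_iff.2 ⟨fun pq hpq => ?_, ?_, fun q hq => ?_, ?_⟩)
    · rw [riesz_linear]
      exact add_nonneg (mul_nonneg ha (hδh pq hpq)) (mul_nonneg hb (hh pq hpq))
    · simp only [Pi.add_apply, Pi.smul_apply, smul_eq_mul, hδ1]
      rw [mul_one, hab]
    · rw [riesz_linear]
      exact add_nonneg (mul_nonneg ha (hδsos q hq)) (mul_nonneg hb (hsos q hq))
    · intro i j β γ hi hj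
      rw [riesz_linear]
      exact add_nonneg (mul_nonneg ha (hδsd i j β γ hi hj)) (mul_nonneg hb (hsd i j β γ hi hj))
  have hyf' : riesz y f - μ * y ⟨0, by simp⟩ < 0 := by
    rw [← riesz_C, ← rieszHom_apply, ← rieszHom_apply, ← map_sub]
    exact hyf
  have hy0 : 0 ≤ y ⟨0, by simp⟩ := by
    have := hh 0 zero_mem_levelIdx
    rwa [hPoly_zero, ← C_1, riesz_C, one_mul] at this
  rcases hy0.eq_or_lt with h0 | h0
  · rw [← h0, mul_zero, sub_zero] at hyf'
    -- Here `y₀ = 0` and `L_y(f) < 0`, so `y` is a direction of descent at `δ`. This multiple lowers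
    -- the value to `L_δ(f) - |L_δ(f) - μ| - 1 < μ`.
    have := hcomb 1 ((|riesz δ f - μ| + 1) / -riesz y f) zero_le_one
      (div_nonneg (by positivity) (by linarith)) (by rw [← h0]; ring)
    rw [div_mul_eq_mul_div, div_neg, mul_div_cancel_right₀ _ hyf'.ne] at this
    linarith [le_abs_self (riesz δ f - μ)]
  · have := hcomb 0 (y ⟨0, by simp⟩)⁻¹ le_rfl (inv_nonneg.2 h0.le)
      (by rw [inv_mul_cancel₀ h0.ne', zero_add])
    rw [zero_mul, zero_add, inv_mul_eq_div, le_div_iff₀ h0] at this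
    linarith

end StrongDuality

end SDPSOCP

/-! ### The main theorem -/

theorem theorem3p1 (n₁ n₂ m d : ℕ)
    (f : MvPolynomial (Fin (n₁ + n₂)) ℝ) (g : Fin m → MvPolynomial (Fin (n₁ + n₂)) ℝ)
    (hf : f.totalDegree ≤ d) (hg : ∀ i, (g i).totalDegree ≤ d)
    (hK_ne : (SDPSOCP.feasibleSet g).Nonempty) (hK : IsCompact (SDPSOCP.feasibleSet g))
    (hgen : Algebra.adjoin ℝ (insert 1 (Set.range g)) = ⊤)
    (M : ℝ) (hM : 0 < M)
    (hMg : ∀ i, sSup ((fun x => MvPolynomial.eval x (g i)) '' SDPSOCP.feasibleSet g) < M)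
    (r : ℕ) (hr : Even r) (hr0 : 0 < r) :
    ((∀ k : ℕ, 1 ≤ k →
        SDPSOCP.valRP n₁ n₂ f g M r k ≤ SDPSOCP.valRP n₁ n₂ f g M r (k + 1) ∧
        SDPSOCP.valDRP n₁ n₂ f g M d r k ≤ SDPSOCP.valDRP n₁ n₂ f g M d r (k + 1) ∧
        SDPSOCP.valRP n₁ n₂ f g M r k ≤ SDPSOCP.valDRP n₁ n₂ f g M d r k ∧
        SDPSOCP.valDRP n₁ n₂ f g M d r k ≤ SDPSOCP.valP f g) ∧
      Tendsto (fun k : ℕ => SDPSOCP.valRP n₁ n₂ f g M r k) atTop (𝓝 (SDPSOCP.valP f g)) ∧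
      Tendsto (fun k : ℕ => SDPSOCP.valDRP n₁ n₂ f g M d r k) atTop (𝓝 (SDPSOCP.valP f g))) ∧
    ((interior (SDPSOCP.feasibleSet g)).Nonempty →
      (∃ x₀ ∈ SDPSOCP.feasibleSet g, ∀ i, 0 < MvPolynomial.eval x₀ (g i)) →
      ∀ k : ℕ, 1 ≤ k →
        SDPSOCP.valRP n₁ n₂ f g M r k = SDPSOCP.valDRP n₁ n₂ f g M d r k ∧
        (SDPSOCP.valRP n₁ n₂ f g M r k ≠ ⊥ →
          ∃ μ ∈ SDPSOCP.feasRP n₁ n₂ f g M r k,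
            (μ : EReal) = SDPSOCP.valRP n₁ n₂ f g M r k)) := by
  -- Compactness of `K` makes the real `sSup` a true upper bound rather than a default value.
  have hgM : ∀ x ∈ SDPSOCP.feasibleSet g, ∀ i, eval x (g i) < M := fun x hx i =>
    (le_csSup (hK.image (MvPolynomial.continuous_eval (g i))).bddAbove ⟨x, hx, rfl⟩).trans_lt
      (hMg i)
  have hgM' : ∀ x ∈ SDPSOCP.feasibleSet g, ∀ i, eval x (g i) ≤ M := fun x hx i => (hgM x hx i).le
  have hle : ∀ k, SDPSOCP.valRP n₁ n₂ f g M r k ≤ SDPSOCP.valDRP n₁ n₂ f g M d r k :=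
    fun k => SDPSOCP.valRP_le_valDRP hr
  have hleP : ∀ k, 1 ≤ k → SDPSOCP.valDRP n₁ n₂ f g M d r k ≤ SDPSOCP.valP f g :=
    fun k hk => SDPSOCP.valDRP_le_valP hf hg hM hgM' hk
  refine ⟨⟨fun k hk => ⟨SDPSOCP.valRP_mono k.le_succ, SDPSOCP.valDRP_le_succ hf hg hk, hle k,
    hleP k hk⟩, tendsto_order.2 ⟨fun a ha => SDPSOCP.eventually_lt_valRP hM hgen ha, ?_⟩,
    tendsto_order.2 ⟨fun a ha => ?_, ?_⟩⟩, fun hint hslater k hk => ?_⟩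
  · intro a ha
    filter_upwards [eventually_ge_atTop 1] with k hk
    exact ((hle k).trans (hleP k hk)).trans_lt ha
  · filter_upwards [SDPSOCP.eventually_lt_valRP (r := r) hM hgen ha] with k hk
    exact hk.trans_le (hle k)
  · intro a ha
    filter_upwards [eventually_ge_atTop 1] with k hk
    exact (hleP k hk).trans_lt ha
  · obtain ⟨x, hx⟩ := hK_ne
    have htop : SDPSOCP.valDRP n₁ n₂ f g M d r k ≠ ⊤ :=
      (((hleP k hk).trans (iInf₂_le x hx)).trans_lt (EReal.coe_lt_top _)).ne
    -- If the dual value is `-∞`, so is the primal one. Otherwise it is a real number, a lower bound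
    -- for itself, and hence a primal feasible `μ`.
    by_cases hbot : SDPSOCP.valDRP n₁ n₂ f g M d r k = ⊥
    · have h := hle k
      rw [hbot, le_bot_iff] at h
      exact ⟨h.trans hbot.symm, fun h' => absurd h h'⟩
    · have hcoe := EReal.coe_toReal htop hbot
      have hmem := SDPSOCP.mem_feasRP_of_le_valDRP hf hg hM hgM hint hslater hk hcoe.le
      have heq : SDPSOCP.valRP n₁ n₂ f g M r k = SDPSOCP.valDRP n₁ n₂ f g M d r k := by
        refine le_antisymm (hle k) (hcoe.ge.trans ?_)
        exact le_iSup₂ (f := fun (μ : ℝ) (_ : μ ∈ SDPSOCP.feasRP n₁ n₂ f g M r k) =>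
          (μ : EReal)) _ hmem
      exact ⟨heq, fun _ => ⟨_, hmem, hcoe.trans heq.symm⟩⟩
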